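/- Let $k$ be a field. All coalgebras are coassociative and counital over $k$. A right coideal of a coalgebra $C$ is a subspace $N\subseteq C$ with $\Delta(N)\subseteq N\otimes C$; right coideals form a lattice under sum and intersection. $C$ is a chain coalgebra if $C\neq 0$ and this lattice is a chain, and $C$ is distributive if this lattice is distributive. $C$ is pointed if every simple subcoalgebra of $C$ is one-dimensional. The divided power coalgebra $\mathcal{DC}$ over $k$ has basis $\{c_n : n\in\mathbb N\}$, where $\mathbb N=\{0,1,2,\dots\}$, with $\Delta(c_n)=\sum_{i=0}^n c_i\otimes c_{n-i}$ and $\varepsilon(c_n)=\delta_{0,n}$. For a $k$-algebra $A$, let $A^\circ$ be its finite dual coalgebra: the space of linear forms on $A$ vanishing on some two-sided ideal of finite codimension, with $\Delta f=\sum g_i\otimes h_i$ if $f(ab)=\sum g_i(a)h_i(b)$ for all $a,b \in A$, and $\varepsilon(f)=f(1)$; if $A$ is finite-dimensional, then $A^\circ=A^*$. 1. A coalgebra over $k$ is a pointed chain coalgebra if and only if it is isomorphic to a nonzero subcoalgebra of $\mathcal{DC}$. 2. A coalgebra over $k$ is isomorphic to a nonzero subcoalgebra of $\mathcal{DC}$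 if and only if it is isomorphic to $(k[x]/\langle x^n\rangle)^*$ for some integer $n>0$ or to $k[[x]]^\circ$. 3. Suppose that $k$ is algebraically closed. Then a coalgebra over $k$ is a chain coalgebra if and only if it is isomorphic to a nonzero subcoalgebra of $\mathcal{DC}$, and it is distributive if and only if it is isomorphic to a coproduct (direct sum, over a possibly empty index set) of nonzero subcoalgebras of $\mathcal{DC}$. -/

import Mathlib

open scoped TensorProduct

universe u v

noncomputable section

/-! ### Tensor products over a field -/

namespace CoalgTensor

variable {k : Type u} [Field k]

/-- A tensor `z ∈ M ⊗ C` lies in `N ⊗ C` iff all its slices `(id ⊗ f) z` lie in `N`. -/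
theorem mem_range_rTensor_iff {M C : Type*} [AddCommGroup M] [Module k M] [AddCommGroup C]
    [Module k C] (N : Submodule k M) (z : M ⊗[k] C) :
    z ∈ LinearMap.range (LinearMap.rTensor C N.subtype) ↔
      ∀ f : C →ₗ[k] k, TensorProduct.rid k M (LinearMap.lTensor M f z) ∈ N := by
  classical
  constructor
  · rintro ⟨t, rfl⟩ f
    induction t using TensorProduct.induction_on with
    | zero => simp
    | tmul x y => simpa using N.smul_mem _ x.2
    | add x y hx hy => simpa using N.add_mem hx hy
  · intro h
    let b := Module.Basis.ofVectorSpace k C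
    have key : z = (TensorProduct.equivFinsuppOfBasisRight b z).sum
        fun i m => m ⊗ₜ[k] b i := by
      conv_lhs => rw [← (TensorProduct.equivFinsuppOfBasisRight (M := M) b).symm_apply_apply z]
      rw [TensorProduct.equivFinsuppOfBasisRight_symm_apply]
    have coeff : ∀ (z : M ⊗[k] C) i, TensorProduct.equivFinsuppOfBasisRight b z i =
        TensorProduct.rid k M (LinearMap.lTensor M (b.coord i) z) := by
      intro z i
      induction z using TensorProduct.induction_on with
      | zero => simp
      | tmul x y => simp [TensorProduct.equivFinsuppOfBasisRight_apply_tmul]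
      | add x y hx hy => simp [hx, hy]
    rw [key]
    refine Submodule.sum_mem _ fun i _ => ?_
    refine ⟨(⟨_, ?_⟩ : N) ⊗ₜ[k] b i, by simp; rfl⟩
    rw [coeff]
    exact h _

/-- Over a field, the canonical map `X* ⊗ Y* → (X ⊗ Y)*` is injective. -/
theorem dualDistrib_injective (X Y : Type*) [AddCommGroup X] [Module k X] [AddCommGroup Y]
    [Module k Y] : Function.Injective (TensorProduct.dualDistrib k X Y) := by
  classical
  rw [injective_iff_map_eq_zero]
  intro z hz
  let b := Module.Basis.ofVectorSpace k (Module.Dual k Y)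
  have coeff : ∀ (z : Module.Dual k X ⊗[k] Module.Dual k Y) x y,
      TensorProduct.dualDistrib k X Y z (x ⊗ₜ y) =
      ((TensorProduct.equivFinsuppOfBasisRight b z).sum fun i f => f x • b i) y := by
    intro z x y
    conv_lhs => rw [← (TensorProduct.equivFinsuppOfBasisRight
      (M := Module.Dual k X) b).symm_apply_apply z]
    rw [TensorProduct.equivFinsuppOfBasisRight_symm_apply]
    simp [Finsupp.sum, LinearMap.sum_apply]
  rw [← (TensorProduct.equivFinsuppOfBasisRight (M := Module.Dual k X) b).map_eq_zero_iff]
  ext i x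
  have h0 : ((TensorProduct.equivFinsuppOfBasisRight b z).sum fun i f => f x • b i) = 0 := by
    ext y
    rw [← coeff, hz]
    simp
  have := (linearIndependent_iff'.1 b.linearIndependent) _ _ h0 i
  by_cases hi : i ∈ (TensorProduct.equivFinsuppOfBasisRight b z).support
  · simpa using this hi
  · simp [Finsupp.notMem_support_iff.1 hi]

end CoalgTensor

/-! ### Right coideals, chain coalgebras and distributive coalgebras -/

section Coideals

variable (k : Type u) (C : Type v) [Field k] [AddCommGroup C] [Module k C] [Coalgebra k C]

/-- A right coideal of `C` is a right subcomodule of `C`: a subspace `N` with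
`Δ(N) ⊆ N ⊗ C`. -/
def IsRightCoideal (N : Submodule k C) : Prop :=
  ∀ x ∈ N, (Coalgebra.comul x : C ⊗[k] C) ∈ LinearMap.range (LinearMap.rTensor C N.subtype)

/-- The lattice of right coideals of `C`; join is the sum and meet is the intersection of
subspaces. -/
def rightCoideals : Sublattice (Submodule k C) where
  carrier := {N | IsRightCoideal k C N}
  supClosed' := by
    intro N hN L hL x hx
    rw [CoalgTensor.mem_range_rTensor_iff]
    intro f
    obtain ⟨y, hy, z, hz, rfl⟩ := Submodule.mem_sup.1 hx
    rw [map_add, map_add, map_add]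
    exact Submodule.add_mem_sup ((CoalgTensor.mem_range_rTensor_iff _ _).1 (hN y hy) f)
      ((CoalgTensor.mem_range_rTensor_iff _ _).1 (hL z hz) f)
  infClosed' := by
    intro N hN L hL x hx
    rw [CoalgTensor.mem_range_rTensor_iff]
    exact fun f => ⟨(CoalgTensor.mem_range_rTensor_iff _ _).1 (hN x hx.1) f,
      (CoalgTensor.mem_range_rTensor_iff _ _).1 (hL x hx.2) f⟩

/-- A chain coalgebra is a nonzero coalgebra whose lattice of right coideals is a chain. -/
structure IsChainCoalgebra : Prop where
  nontrivial : Nontrivial C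
  le_or_le : ∀ N L : rightCoideals k C, N ≤ L ∨ L ≤ N

/-- A coalgebra is distributive if its lattice of right coideals is distributive. -/
def IsDistributiveCoalgebra : Prop :=
  ∀ N L M : rightCoideals k C, N ⊓ (L ⊔ M) = (N ⊓ L) ⊔ (N ⊓ M)

end Coideals

/-! ### Subcoalgebras -/

/-- A subcoalgebra of `C` is a subspace `D` with `Δ(D) ⊆ D ⊗ D`. -/
structure Subcoalgebra (k : Type u) (C : Type v) [Field k] [AddCommGroup C] [Module k C]
    [Coalgebra k C] extends Submodule k C where
  comul_mem' : ∀ x ∈ toSubmodule, (Coalgebra.comul x : C ⊗[k] C) ∈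
    LinearMap.range (TensorProduct.map toSubmodule.subtype toSubmodule.subtype)

namespace Subcoalgebra

variable {k : Type u} {C : Type v} [Field k] [AddCommGroup C] [Module k C] [Coalgebra k C]
  (D : Subcoalgebra k C)

theorem map_subtype_injective : Function.Injective
    (TensorProduct.map D.toSubmodule.subtype D.toSubmodule.subtype) :=
  TensorProduct.map_injective_of_flat_flat _ _ D.toSubmodule.injective_subtype
    D.toSubmodule.injective_subtype

/-- The comultiplication of `D`: the restriction of that of `C`. -/
def comulAux : D.toSubmodule →ₗ[k] D.toSubmodule ⊗[k] D.toSubmodule :=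
  (LinearEquiv.ofInjective _ D.map_subtype_injective).symm.toLinearMap ∘ₗ
    LinearMap.codRestrict _ (Coalgebra.comul ∘ₗ D.toSubmodule.subtype)
      fun x => D.comul_mem' x x.2

theorem map_subtype_comulAux (x : D.toSubmodule) :
    TensorProduct.map D.toSubmodule.subtype D.toSubmodule.subtype (D.comulAux x) =
      Coalgebra.comul (x : C) := by
  have := LinearEquiv.apply_symm_apply (LinearEquiv.ofInjective _ D.map_subtype_injective)
    (LinearMap.codRestrict _ (Coalgebra.comul ∘ₗ D.toSubmodule.subtype)
      (fun x => D.comul_mem' x x.2) x)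
  exact congrArg Subtype.val this

theorem map_subtype_comp_comulAux :
    TensorProduct.map D.toSubmodule.subtype D.toSubmodule.subtype ∘ₗ D.comulAux =
      Coalgebra.comul ∘ₗ D.toSubmodule.subtype :=
  LinearMap.ext D.map_subtype_comulAux

instance instCoalgebraStruct : CoalgebraStruct k D.toSubmodule where
  comul := D.comulAux
  counit := Coalgebra.counit ∘ₗ D.toSubmodule.subtype

instance instCoalgebra : Coalgebra k D.toSubmodule where
  coassoc := by
    change _ ∘ₗ LinearMap.rTensor _ D.comulAux ∘ₗ D.comulAux =
      LinearMap.lTensor _ D.comulAux ∘ₗ D.comulAux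
    have hinj := TensorProduct.map_injective_of_flat_flat _ _ D.toSubmodule.injective_subtype
      D.map_subtype_injective
    refine LinearMap.ext fun x => hinj ?_
    have h1 : ∀ z : D.toSubmodule ⊗[k] D.toSubmodule,
        TensorProduct.map D.toSubmodule.subtype
          (TensorProduct.map D.toSubmodule.subtype D.toSubmodule.subtype)
          (TensorProduct.assoc k _ _ _ (LinearMap.rTensor _ D.comulAux z)) =
        TensorProduct.assoc k C C C (LinearMap.rTensor C Coalgebra.comul
          (TensorProduct.map D.toSubmodule.subtype D.toSubmodule.subtype z)) := by
      intro z
      induction z using TensorProduct.induction_on with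
      | zero => simp
      | tmul a b =>
        simp only [LinearMap.rTensor_tmul, TensorProduct.map_tmul, Submodule.subtype_apply]
        rw [← D.map_subtype_comulAux]
        generalize D.comulAux a = t
        induction t using TensorProduct.induction_on with
        | zero => simp
        | tmul a b => simp
        | add x y hx hy => simp [TensorProduct.add_tmul, hx, hy]
      | add x y hx hy => simp only [map_add, hx, hy]
    have h2 : ∀ z : D.toSubmodule ⊗[k] D.toSubmodule,
        TensorProduct.map D.toSubmodule.subtype
          (TensorProduct.map D.toSubmodule.subtype D.toSubmodule.subtype)
          (LinearMap.lTensor _ D.comulAux z) =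
        LinearMap.lTensor C Coalgebra.comul
          (TensorProduct.map D.toSubmodule.subtype D.toSubmodule.subtype z) := by
      intro z
      induction z using TensorProduct.induction_on with
      | zero => simp
      | tmul a b => simp [D.map_subtype_comulAux]
      | add x y hx hy => simp only [map_add, hx, hy]
    simp only [LinearMap.comp_apply, LinearEquiv.coe_coe]
    rw [h1, h2, D.map_subtype_comulAux]
    exact Coalgebra.coassoc_apply _
  rTensor_counit_comp_comul := by
    change LinearMap.rTensor _ (Coalgebra.counit ∘ₗ D.toSubmodule.subtype) ∘ₗ D.comulAux = _
    have hinj : Function.Injective (LinearMap.lTensor k D.toSubmodule.subtype) :=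
      Module.Flat.lTensor_preserves_injective_linearMap _ D.toSubmodule.injective_subtype
    refine LinearMap.ext fun x => hinj ?_
    have h : ∀ z : D.toSubmodule ⊗[k] D.toSubmodule,
        LinearMap.lTensor k D.toSubmodule.subtype
          (LinearMap.rTensor _ (Coalgebra.counit ∘ₗ D.toSubmodule.subtype) z) =
        LinearMap.rTensor C Coalgebra.counit
          (TensorProduct.map D.toSubmodule.subtype D.toSubmodule.subtype z) := by
      intro z
      induction z using TensorProduct.induction_on with
      | zero => simp
      | tmul a b => simp
      | add x y hx hy => simp only [map_add, hx, hy]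
    rw [LinearMap.comp_apply, h, D.map_subtype_comulAux, Coalgebra.rTensor_counit_comul]
    simp
  lTensor_counit_comp_comul := by
    change LinearMap.lTensor _ (Coalgebra.counit ∘ₗ D.toSubmodule.subtype) ∘ₗ D.comulAux = _
    have hinj : Function.Injective (LinearMap.rTensor k D.toSubmodule.subtype) :=
      Module.Flat.rTensor_preserves_injective_linearMap _ D.toSubmodule.injective_subtype
    refine LinearMap.ext fun x => hinj ?_
    have h : ∀ z : D.toSubmodule ⊗[k] D.toSubmodule,
        LinearMap.rTensor k D.toSubmodule.subtype
          (LinearMap.lTensor _ (Coalgebra.counit ∘ₗ D.toSubmodule.subtype) z) =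
        LinearMap.lTensor C Coalgebra.counit
          (TensorProduct.map D.toSubmodule.subtype D.toSubmodule.subtype z) := by
      intro z
      induction z using TensorProduct.induction_on with
      | zero => simp
      | tmul a b => simp
      | add x y hx hy => simp only [map_add, hx, hy]
    rw [LinearMap.comp_apply, h, D.map_subtype_comulAux, Coalgebra.lTensor_counit_comul]
    simp

/-- A subcoalgebra is simple if it is nonzero and its only subcoalgebras (that is, the
subcoalgebras of `C` contained in it) are `0` and itself. -/
def IsSimple : Prop :=
  D.toSubmodule ≠ ⊥ ∧ ∀ E : Subcoalgebra k C, E.toSubmodule ≤ D.toSubmodule →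
    E.toSubmodule = ⊥ ∨ E.toSubmodule = D.toSubmodule

end Subcoalgebra

/-- A coalgebra is pointed if each of its simple subcoalgebras is one-dimensional. -/
def IsPointedCoalgebra (k : Type u) (C : Type v) [Field k] [AddCommGroup C] [Module k C]
    [Coalgebra k C] : Prop :=
  ∀ D : Subcoalgebra k C, D.IsSimple → Module.finrank k D.toSubmodule = 1

/-! ### The divided power coalgebra -/

/-- The underlying space of the divided power coalgebra over `k`, with basis `c 0, c 1, …`. -/
def DividedPower (k : Type u) [Field k] : Type u := ℕ →₀ k

namespace DividedPower

variable (k : Type u) [Field k]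

instance : AddCommGroup (DividedPower k) := inferInstanceAs (AddCommGroup (ℕ →₀ k))

instance : Module k (DividedPower k) := inferInstanceAs (Module k (ℕ →₀ k))

/-- The basis `(c n)` of the divided power coalgebra. -/
def c : Module.Basis ℕ k (DividedPower k) := Module.Basis.ofRepr (LinearEquiv.refl k (ℕ →₀ k))

/-- `Δ (c n) = ∑_{i + j = n} c i ⊗ c j` and `ε (c n) = δ_{0,n}`. -/
instance instCoalgebraStruct : CoalgebraStruct k (DividedPower k) where
  comul := (c k).constr k fun n => ∑ p ∈ Finset.HasAntidiagonal.antidiagonal n, c k p.1 ⊗ₜ[k] c k p.2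
  counit := (c k).constr k fun n => if n = 0 then 1 else 0

theorem comul_c (n : ℕ) : (Coalgebra.comul (c k n) : DividedPower k ⊗[k] DividedPower k) =
    ∑ p ∈ Finset.HasAntidiagonal.antidiagonal n, c k p.1 ⊗ₜ[k] c k p.2 :=
  (c k).constr_basis k _ n

theorem counit_c (n : ℕ) : (Coalgebra.counit (c k n) : k) = if n = 0 then 1 else 0 :=
  (c k).constr_basis k (fun n => if n = 0 then 1 else 0) n

instance instCoalgebra : Coalgebra k (DividedPower k) where
  coassoc := by
    refine (c k).ext fun n => ?_
    simp only [LinearMap.comp_apply, comul_c, map_sum, LinearMap.rTensor_tmul,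
      LinearMap.lTensor_tmul, TensorProduct.sum_tmul, TensorProduct.tmul_sum,
      LinearEquiv.coe_coe, TensorProduct.assoc_tmul]
    rw [Finset.sum_sigma', Finset.sum_sigma']
    refine Finset.sum_nbij' (fun x => ⟨(x.2.1, x.2.2 + x.1.2), (x.2.2, x.1.2)⟩)
      (fun x => ⟨(x.1.1 + x.2.1, x.2.2), (x.1.1, x.2.1)⟩) ?_ ?_ ?_ ?_ ?_
    · rintro ⟨⟨a, b⟩, d, e⟩ h
      simp at h ⊢
      omega
    · rintro ⟨⟨a, b⟩, d, e⟩ h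
      simp at h ⊢
      omega
    · rintro ⟨⟨a, b⟩, d, e⟩ h
      simp at h
      simp [h]
    · rintro ⟨⟨a, b⟩, d, e⟩ h
      simp at h
      simp [h]
    · intro _ _
      rfl
  rTensor_counit_comp_comul := by
    refine (c k).ext fun n => ?_
    simp only [LinearMap.comp_apply, comul_c, map_sum, LinearMap.rTensor_tmul, counit_c]
    rw [Finset.sum_eq_single (0, n)]
    · simp
    · rintro ⟨a, b⟩ h hne
      have : a ≠ 0 := by
        rintro rfl
        simp at h
        simp [h] at hne
      simp [this]
    · simp
  lTensor_counit_comp_comul := by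
    refine (c k).ext fun n => ?_
    simp only [LinearMap.comp_apply, comul_c, map_sum, LinearMap.lTensor_tmul, counit_c]
    rw [Finset.sum_eq_single (n, 0)]
    · simp
    · rintro ⟨a, b⟩ h hne
      have : b ≠ 0 := by
        rintro rfl
        simp at h
        simp [h] at hne
      simp [this]
    · simp

end DividedPower

/-! ### The finite dual of an algebra -/

section FiniteDual

variable (k : Type u) (A : Type v) [Field k] [Ring A] [Algebra k A]

/-- The finite dual `A°` of a `k`-algebra `A`: the linear forms on `A` that vanish on a two-sided
ideal of finite codimension. -/
def finiteDual : Submodule k (Module.Dual k A) where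
  carrier := {f | ∃ I : Ideal A, I.IsTwoSided ∧ Module.Finite k (A ⧸ I.restrictScalars k) ∧
    ∀ a ∈ I, f a = 0}
  zero_mem' := ⟨⊤, inferInstance, by
    have : Subsingleton (A ⧸ (⊤ : Ideal A).restrictScalars k) :=
      Submodule.Quotient.subsingleton_iff.2 (by simp)
    infer_instance, by simp⟩
  add_mem' := by
    rintro f g ⟨I, hI, hIf, hf⟩ ⟨J, hJ, hJf, hg⟩
    refine ⟨I ⊓ J, ⟨fun b ha => ⟨hI.mul_mem_of_left b ha.1, hJ.mul_mem_of_left b ha.2⟩⟩, ?_,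
      fun a ha => by simp [hf a ha.1, hg a ha.2]⟩
    let φ : A →ₗ[k] (A ⧸ I.restrictScalars k) × (A ⧸ J.restrictScalars k) :=
      (Submodule.mkQ _).prod (Submodule.mkQ _)
    have hφ : LinearMap.ker φ = (I ⊓ J).restrictScalars k := by
      ext x
      simp [φ, LinearMap.ker_prod]
    rw [← hφ]
    exact Module.Finite.equiv φ.quotKerEquivRange.symm
  smul_mem' := by
    rintro r f ⟨I, hI, hIf, hf⟩
    exact ⟨I, hI, hIf, fun a ha => by simp [hf a ha]⟩

/-- For a finite-dimensional algebra the finite dual is the whole dual space. -/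
theorem finiteDual_eq_top [Module.Finite k A] : finiteDual k A = ⊤ :=
  eq_top_iff.2 fun f _ => ⟨⊥, inferInstance, inferInstance, by simp⟩

namespace finiteDual

/-- The canonical map `A° ⊗ A° → (A ⊗ A)*`, `g ⊗ h ↦ (a ⊗ b ↦ g a * h b)`. -/
def pairing : finiteDual k A ⊗[k] finiteDual k A →ₗ[k] Module.Dual k (A ⊗[k] A) :=
  TensorProduct.dualDistrib k A A ∘ₗ
    TensorProduct.map (finiteDual k A).subtype (finiteDual k A).subtype

variable {k A} in
@[simp]
theorem pairing_tmul (g h : finiteDual k A) (a b : A) :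
    pairing k A (g ⊗ₜ h) (a ⊗ₜ b) = g.1 a * h.1 b := by
  simp [pairing]

instance : Module.Free k (finiteDual k A) := Module.Free.of_divisionRing k (finiteDual k A)

theorem pairing_injective : Function.Injective (pairing k A) := by
  rw [pairing, LinearMap.coe_comp]
  exact (CoalgTensor.dualDistrib_injective A A).comp
    (TensorProduct.map_injective_of_flat_flat _ _ (finiteDual k A).injective_subtype
      (finiteDual k A).injective_subtype)

variable {k A} in
theorem mul_mem_range_pairing (f : finiteDual k A) :
    f.1 ∘ₗ LinearMap.mul' k A ∈ LinearMap.range (pairing k A) := by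
  obtain ⟨f, I, hI, hfin, hf⟩ := f
  let Q := A ⧸ I.restrictScalars k
  let e := Module.Free.chooseBasis k Q
  let π : A →ₗ[k] Q := (I.restrictScalars k).mkQ
  have hπ : ∀ a ∈ I, π a = 0 := fun a ha => by
    have := (I.restrictScalars k).ker_mkQ
    exact LinearMap.mem_ker.1 (this.symm ▸ ha : a ∈ LinearMap.ker π)
  have hker : ∀ a, π a = 0 → a ∈ I := fun a ha => by
    have := (I.restrictScalars k).ker_mkQ
    exact (Submodule.restrictScalars_mem k I a).1 (this ▸ LinearMap.mem_ker.2 ha)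
  choose s hs using fun i => (I.restrictScalars k).mkQ_surjective (e i)
  let g : ∀ i, finiteDual k A := fun i => ⟨e.coord i ∘ₗ π, I, hI, hfin, fun a ha => by
    simp [hπ a ha]⟩
  let h : ∀ i, finiteDual k A := fun i => ⟨f ∘ₗ LinearMap.mulLeft k (s i), I, hI, hfin,
    fun a ha => hf _ (I.mul_mem_left _ ha)⟩
  refine ⟨∑ i, g i ⊗ₜ h i, ?_⟩
  ext a b
  simp only [map_sum, LinearMap.sum_apply, TensorProduct.AlgebraTensorModule.curry_apply,
    LinearMap.restrictScalars_self, TensorProduct.curry_apply, pairing_tmul]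
  simp only [g, h, LinearMap.comp_apply, LinearMap.mulLeft_apply, Module.Basis.coord_apply,
    LinearMap.mul'_apply]
  have h1 : a - ∑ i, e.repr (π a) i • s i ∈ I := by
    apply hker
    rw [map_sub, map_sum]
    simp only [map_smul, π, hs]
    rw [Module.Basis.sum_repr, sub_self]
  have h2 := hf _ (hI.mul_mem_of_left b h1)
  rw [sub_mul, map_sub, sub_eq_zero, Finset.sum_mul, map_sum] at h2
  rw [h2]
  simp

/-- The comultiplication of `A°`: the unique `Δ` with `Δ f = ∑ g ⊗ h` whenever
`f (a * b) = ∑ g a * h b` for all `a b`. -/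
def comulAux : finiteDual k A →ₗ[k] finiteDual k A ⊗[k] finiteDual k A :=
  (LinearEquiv.ofInjective _ (pairing_injective k A)).symm.toLinearMap ∘ₗ
    LinearMap.codRestrict _
      ((LinearMap.lcomp k k (LinearMap.mul' k A)) ∘ₗ (finiteDual k A).subtype)
      fun f => mul_mem_range_pairing f

variable {k A} in
theorem pairing_comulAux (f : finiteDual k A) :
    pairing k A (comulAux k A f) = f.1 ∘ₗ LinearMap.mul' k A := by
  have := LinearEquiv.apply_symm_apply (LinearEquiv.ofInjective _ (pairing_injective k A))
    (LinearMap.codRestrict _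
      ((LinearMap.lcomp k k (LinearMap.mul' k A)) ∘ₗ (finiteDual k A).subtype)
      (fun f => mul_mem_range_pairing f) f)
  exact congrArg Subtype.val this

/-- The counit of `A°` is evaluation at `1`. -/
instance instCoalgebraStruct : CoalgebraStruct k (finiteDual k A) where
  comul := comulAux k A
  counit := LinearMap.applyₗ (1 : A) ∘ₗ (finiteDual k A).subtype

/-- The canonical map `A° ⊗ (A° ⊗ A°) → (A ⊗ (A ⊗ A))*`. -/
def pairing₃ : finiteDual k A ⊗[k] (finiteDual k A ⊗[k] finiteDual k A) →ₗ[k]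
    Module.Dual k (A ⊗[k] (A ⊗[k] A)) :=
  TensorProduct.dualDistrib k A (A ⊗[k] A) ∘ₗ
    TensorProduct.map (finiteDual k A).subtype (pairing k A)

theorem pairing₃_injective : Function.Injective (pairing₃ k A) := by
  rw [pairing₃, LinearMap.coe_comp]
  exact (CoalgTensor.dualDistrib_injective A (A ⊗[k] A)).comp
    (TensorProduct.map_injective_of_flat_flat _ _ (finiteDual k A).injective_subtype
      (pairing_injective k A))

instance instCoalgebra : Coalgebra k (finiteDual k A) where
  coassoc := by
    change _ ∘ₗ LinearMap.rTensor _ (comulAux k A) ∘ₗ comulAux k A =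
      LinearMap.lTensor _ (comulAux k A) ∘ₗ comulAux k A
    refine LinearMap.ext fun f => pairing₃_injective k A ?_
    have h1 : ∀ (z : finiteDual k A ⊗[k] finiteDual k A) (a b d : A),
        pairing₃ k A (TensorProduct.assoc k _ _ _ (LinearMap.rTensor _ (comulAux k A) z))
          (a ⊗ₜ (b ⊗ₜ d)) = pairing k A z ((a * b) ⊗ₜ d) := by
      intro z a b d
      induction z using TensorProduct.induction_on with
      | zero => simp
      | tmul g h =>
        have e1 : ∀ t : finiteDual k A ⊗[k] finiteDual k A,
            pairing₃ k A (TensorProduct.assoc k _ _ _ (t ⊗ₜ h)) (a ⊗ₜ (b ⊗ₜ d)) =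
            pairing k A t (a ⊗ₜ b) * h.1 d := by
          intro t
          induction t using TensorProduct.induction_on with
          | zero => simp
          | tmul x y => simp [pairing₃, mul_assoc]
          | add x y hx hy =>
            simp only [TensorProduct.add_tmul, map_add, LinearMap.add_apply, hx, hy, add_mul]
        rw [LinearMap.rTensor_tmul, e1, pairing_comulAux]
        simp
      | add x y hx hy => simp only [map_add, LinearMap.add_apply, hx, hy]
    have h2 : ∀ (z : finiteDual k A ⊗[k] finiteDual k A) (a b d : A),
        pairing₃ k A (LinearMap.lTensor _ (comulAux k A) z)
          (a ⊗ₜ (b ⊗ₜ d)) = pairing k A z (a ⊗ₜ (b * d)) := by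
      intro z a b d
      induction z using TensorProduct.induction_on with
      | zero => simp
      | tmul g h => simp [pairing₃, pairing_comulAux]
      | add x y hx hy => simp only [map_add, LinearMap.add_apply, hx, hy]
    ext a b d
    simp only [TensorProduct.AlgebraTensorModule.curry_apply, LinearMap.restrictScalars_self,
      TensorProduct.curry_apply, LinearMap.comp_apply, LinearEquiv.coe_coe]
    rw [h1, h2, pairing_comulAux]
    simp [mul_assoc]
  rTensor_counit_comp_comul := by
    change LinearMap.rTensor _ (LinearMap.applyₗ (1 : A) ∘ₗ (finiteDual k A).subtype) ∘ₗ
      comulAux k A = _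
    refine LinearMap.ext fun f => (TensorProduct.lid k _).injective ?_
    have h : ∀ (z : finiteDual k A ⊗[k] finiteDual k A) (a : A),
        (TensorProduct.lid k _ (LinearMap.rTensor _
          (LinearMap.applyₗ (1 : A) ∘ₗ (finiteDual k A).subtype) z)).1 a =
        pairing k A z (1 ⊗ₜ a) := by
      intro z a
      induction z using TensorProduct.induction_on with
      | zero => simp
      | tmul g h => simp
      | add x y hx hy =>
        simp only [map_add, LinearMap.add_apply, ← hx, ← hy, Submodule.coe_add]
    ext a
    rw [LinearMap.comp_apply, h, pairing_comulAux]
    simp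
  lTensor_counit_comp_comul := by
    change LinearMap.lTensor _ (LinearMap.applyₗ (1 : A) ∘ₗ (finiteDual k A).subtype) ∘ₗ
      comulAux k A = _
    refine LinearMap.ext fun f => (TensorProduct.rid k _).injective ?_
    have h : ∀ (z : finiteDual k A ⊗[k] finiteDual k A) (a : A),
        (TensorProduct.rid k _ (LinearMap.lTensor _
          (LinearMap.applyₗ (1 : A) ∘ₗ (finiteDual k A).subtype) z)).1 a =
        pairing k A z (a ⊗ₜ 1) := by
      intro z a
      induction z using TensorProduct.induction_on with
      | zero => simp
      | tmul g h => simp [mul_comm]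
      | add x y hx hy =>
        simp only [map_add, LinearMap.add_apply, ← hx, ← hy, Submodule.coe_add]
    ext a
    rw [LinearMap.comp_apply, h, pairing_comulAux]
    simp

end finiteDual

end FiniteDual

end

/-!
Right coideals of `C` are the subspaces stable under the maps `x ↦ ∑ f(x₂) x₁`, while the maps
`x ↦ ∑ f(x₁) x₂` are colinear and so map right coideals to right coideals.

Let `C` be a pointed chain coalgebra with group-like element `g`. Take a form `f` that vanishes on
`g` but not on the second smallest right coideal. Then `T x = ∑ f(x₁) x₂` is colinear and locally
nilpotent with kernel `k g`, so `x ↦ ∑ₙ ε(Tⁿ x) cₙ` is an injective coalgebra homomorphism into the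
divided power coalgebra. For the finite duals of `k[x]/⟨xⁿ⟩` and `k⟦x⟧` the same construction, with
`f` the evaluation at `x`, has image the span of `c₀, …, cₙ₋₁` and the whole coalgebra, and these
are the only nonzero right coideals there are.

If `C` is distributive, then for right coideals `X` and `Y` the comodules `X / (X ⊓ Y)` and
`Y / (X ⊓ Y)` have no nonzero isomorphic subquotients: the graph of an isomorphism would violate
distributivity. Over an algebraically closed field this forces simple right coideals to be spanned
by group-like elements. In the pointed case it makes the right coideals whose only group-like
element is `g` a chain, and `C` is the direct sum of the corresponding chain coalgebras.
-/

open Coalgebra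

section HitActions

variable {R C : Type*} [CommSemiring R] [AddCommMonoid C] [Module R C] [Coalgebra R C]

/-- The left hit action `f ⇀ x = ∑ f(x₂) x₁` of the dual algebra on a coalgebra. -/
noncomputable def leftHit : Module.Dual R C →ₗ[R] Module.End R C :=
  LinearMap.mk₂ R (fun f x ↦ TensorProduct.rid R C (f.lTensor C (comul x)))
    (by simp [LinearMap.lTensor_add]) (by simp [LinearMap.lTensor_smul]) (by simp) (by simp)

/-- The right hit action `x ↼ f = ∑ f(x₁) x₂` of the dual algebra on a coalgebra. -/
noncomputable def rightHit : Module.Dual R C →ₗ[R] Module.End R C :=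
  LinearMap.mk₂ R (fun f x ↦ TensorProduct.lid R C (f.rTensor C (comul x)))
    (by simp [LinearMap.rTensor_add]) (by simp [LinearMap.rTensor_smul]) (by simp) (by simp)

theorem leftHit_apply (f : Module.Dual R C) (x : C) :
    leftHit f x = TensorProduct.rid R C (f.lTensor C (comul x)) :=
  rfl

theorem rightHit_apply (f : Module.Dual R C) (x : C) :
    rightHit f x = TensorProduct.lid R C (f.rTensor C (comul x)) :=
  rfl

theorem leftHit_eq_sum {ι : Type*} (f : Module.Dual R C) {x : C} (𝓡 : Repr R x ι) :
    leftHit f x = ∑ i ∈ 𝓡.index, f (𝓡.right i) • 𝓡.left i := by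
  simp [leftHit_apply, ← 𝓡.eq]

theorem rightHit_eq_sum {ι : Type*} (f : Module.Dual R C) {x : C} (𝓡 : Repr R x ι) :
    rightHit f x = ∑ i ∈ 𝓡.index, f (𝓡.left i) • 𝓡.right i := by
  simp [rightHit_apply, ← 𝓡.eq]

@[simp]
theorem leftHit_counit (x : C) : leftHit (counit (R := R)) x = x := by
  simp [leftHit_apply]

theorem apply_rightHit (f g : Module.Dual R C) (x : C) : g (rightHit f x) = f (leftHit g x) := by
  simp [rightHit_eq_sum f (ℛ R x), leftHit_eq_sum g (ℛ R x), mul_comm]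

@[simp]
theorem counit_rightHit (f : Module.Dual R C) (x : C) : counit (R := R) (rightHit f x) = f x := by
  rw [apply_rightHit, leftHit_counit]

@[simp]
theorem counit_leftHit (f : Module.Dual R C) (x : C) : counit (R := R) (leftHit f x) = f x := by
  simp [← apply_rightHit, rightHit_apply]

@[simp]
theorem rightHit_counit (x : C) : rightHit (counit (R := R)) x = x := by
  simp [rightHit_apply]

theorem leftHit_leftHit (f g : Module.Dual R C) (x : C) :
    leftHit g (leftHit f x) = leftHit (f ∘ₗ rightHit g) x := by
  have coassoc := congr(TensorProduct.rid R C (LinearMap.lTensor C (f ∘ₗ TensorProduct.lid R C ∘ₗ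
    g.rTensor C) $(sum_tmul_tmul_eq (ℛ R x) (fun i ↦ ℛ R _) (fun i ↦ ℛ R _))))
  simp only [leftHit_eq_sum _ (ℛ R x), map_sum, map_smul, LinearMap.comp_apply,
    leftHit_eq_sum g (ℛ R ((ℛ R x).left _)), rightHit_eq_sum g (ℛ R ((ℛ R x).right _))]
  simpa [Finset.smul_sum, Finset.sum_smul, smul_smul, mul_comm] using coassoc

/-- A `C`-colinear endomorphism of `C` regarded as a right comodule over itself, that is,
`Δ (T x) = ∑ T x₁ ⊗ x₂`. -/
def IsColinear (T : Module.End R C) : Prop :=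
  comul ∘ₗ T = T.rTensor C ∘ₗ comul

theorem isColinear_rightHit (f : Module.Dual R C) : IsColinear (rightHit f) := by
  refine LinearMap.ext fun x ↦ ?_
  have coassoc := congr(TensorProduct.lid R (C ⊗[R] C) (LinearMap.rTensor (C ⊗[R] C) f
    $(sum_tmul_tmul_eq (ℛ R x) (fun i ↦ ℛ R _) (fun i ↦ ℛ R _))))
  simp only [LinearMap.comp_apply, rightHit_eq_sum f (ℛ R x), map_sum, map_smul,
    ← (ℛ R ((ℛ R x).right _)).eq]
  conv_rhs => rw [← (ℛ R x).eq]
  simp only [map_sum, LinearMap.rTensor_tmul, rightHit_eq_sum f (ℛ R ((ℛ R x).left _))]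
  simpa [Finset.smul_sum, TensorProduct.sum_tmul, TensorProduct.smul_tmul'] using coassoc.symm

namespace IsColinear

variable {T : Module.End R C}

theorem comul_apply (hT : IsColinear T) (x : C) : comul (R := R) (T x) = T.rTensor C (comul x) :=
  LinearMap.congr_fun hT x

theorem map_leftHit (hT : IsColinear T) (f : Module.Dual R C) (x : C) :
    T (leftHit f x) = leftHit f (T x) := by
  rw [leftHit_apply, leftHit_apply, hT.comul_apply]
  simp [← (ℛ R x).eq]

theorem one : IsColinear (1 : Module.End R C) := by
  simp [IsColinear, Module.End.one_eq_id]

theorem pow (hT : IsColinear T) (n : ℕ) : IsColinear (T ^ n) := by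
  induction n with
  | zero => exact one
  | succ n ih =>
    refine LinearMap.ext fun x ↦ ?_
    simp [pow_succ, ih.comul_apply, hT.comul_apply, Module.End.mul_eq_comp, LinearMap.rTensor_comp]

end IsColinear

end HitActions

section LinearAlgebra

variable {k V : Type*} [Field k] [AddCommGroup V] [Module k V]

theorem exists_minimal_le_of_finite {P : Submodule k V → Prop} {W : Submodule k V}
    [Module.Finite k W] (hW : P W) : ∃ S ≤ W, Module.Finite k S ∧ Minimal P S := by
  obtain ⟨S, ⟨hSW, hS⟩, hmin⟩ := exists_minimalFor_of_wellFoundedLT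
    (fun S ↦ S ≤ W ∧ P S) (fun S ↦ Module.finrank k S) ⟨W, le_rfl, hW⟩
  have : Module.Finite k S := Submodule.finiteDimensional_of_le hSW
  refine ⟨S, hSW, this, hS, fun L hL hLS ↦ ?_⟩
  have : Module.finrank k S ≤ Module.finrank k L :=
    hmin ⟨hLS.trans hSW, hL⟩ (Submodule.finrank_mono hLS)
  exact (Submodule.eq_of_le_of_finrank_le hLS this).ge

theorem finrank_map_lt_of_inf_ker_ne_bot {N : Submodule k V} [Module.Finite k N]
    {T : Module.End k V} (h : N ⊓ LinearMap.ker T ≠ ⊥) :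
    Module.finrank k (N.map T) < Module.finrank k N := by
  have hker : LinearMap.ker (T.domRestrict N) ≠ ⊥ := by
    obtain ⟨x, ⟨hxN, hxT⟩, hx⟩ := Submodule.exists_mem_ne_zero_of_ne_bot h
    exact Submodule.ne_bot_iff _ |>.2 ⟨⟨x, hxN⟩, hxT, by simpa using hx⟩
  have := LinearMap.finrank_range_add_finrank_ker (T.domRestrict N)
  have := Submodule.one_le_finrank_iff.2 hker
  rw [LinearMap.range_domRestrict] at *
  lia

end LinearAlgebra

section FiberSum

variable {R V W : Type*} [Ring R] [AddCommGroup V] [Module R V] [AddCommGroup W] [Module R W]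

/-- The elements `x + y` with `x ∈ X`, `y ∈ Y` and `u x = v y`, that is, the image of the fibre
product of `X` and `Y` under addition. It plays the role of a diagonal between `X` and `Y`. -/
def fiberSum (X Y : Submodule R V) (u v : V →ₗ[R] W) : Submodule R V :=
  (X.prod Y ⊓ LinearMap.eqLocus (u ∘ₗ LinearMap.fst R V V) (v ∘ₗ LinearMap.snd R V V)).map
    (LinearMap.fst R V V + LinearMap.snd R V V)

theorem mem_fiberSum {X Y : Submodule R V} {u v : V →ₗ[R] W} {d : V} :
    d ∈ fiberSum X Y u v ↔ ∃ x ∈ X, ∃ y ∈ Y, u x = v y ∧ x + y = d := by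
  simp [fiberSum, and_assoc]

end FiberSum

section RightCoideals

variable {k C : Type*} [Field k] [AddCommGroup C] [Module k C] [Coalgebra k C]

theorem isRightCoideal_iff {N : Submodule k C} :
    IsRightCoideal k C N ↔ ∀ f : Module.Dual k C, ∀ x ∈ N, leftHit f x ∈ N := by
  simp only [IsRightCoideal, CoalgTensor.mem_range_rTensor_iff]
  exact ⟨fun h f x hx ↦ h x hx f, fun h x hx f ↦ h f x hx⟩

theorem isRightCoideal_bot : IsRightCoideal k C ⊥ := by
  simp [isRightCoideal_iff]

theorem isRightCoideal_top : IsRightCoideal k C ⊤ := by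
  simp [isRightCoideal_iff]

theorem isRightCoideal_sSup {𝒩 : Set (Submodule k C)} (h𝒩 : ∀ N ∈ 𝒩, IsRightCoideal k C N) :
    IsRightCoideal k C (sSup 𝒩) := by
  refine isRightCoideal_iff.2 fun f ↦ ?_
  change sSup 𝒩 ≤ (sSup 𝒩).comap (leftHit f)
  exact sSup_le fun N hN x hx ↦ le_sSup hN (isRightCoideal_iff.1 (h𝒩 N hN) f x hx)

/-- The right coideal generated by an element, namely its orbit under the left hit action. -/
noncomputable def rightCoidealSpan (x : C) : Submodule k C :=
  LinearMap.range ((leftHit (R := k) (C := C)).flip x)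

theorem leftHit_mem_rightCoidealSpan (f : Module.Dual k C) (x : C) :
    leftHit f x ∈ rightCoidealSpan (k := k) x :=
  ⟨f, rfl⟩

theorem mem_rightCoidealSpan_self (x : C) : x ∈ rightCoidealSpan (k := k) x :=
  ⟨counit, leftHit_counit x⟩

theorem isRightCoideal_rightCoidealSpan (x : C) : IsRightCoideal k C (rightCoidealSpan x) := by
  rw [isRightCoideal_iff]
  rintro g _ ⟨f, rfl⟩
  rw [LinearMap.flip_apply, leftHit_leftHit]
  exact leftHit_mem_rightCoidealSpan _ x

instance finite_rightCoidealSpan (x : C) : Module.Finite k (rightCoidealSpan (k := k) x) := by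
  classical
  let W := Submodule.span k ((ℛ k x).index.image (ℛ k x).left : Set C)
  have : rightCoidealSpan x ≤ W := by
    rintro _ ⟨f, rfl⟩
    rw [LinearMap.flip_apply, leftHit_eq_sum f (ℛ k x)]
    exact W.sum_smul_mem _ fun i hi ↦ Submodule.subset_span (Finset.mem_image_of_mem _ hi)
  exact Submodule.finiteDimensional_of_le this

namespace IsRightCoideal

variable {N L : Submodule k C}

theorem leftHit_mem (hN : IsRightCoideal k C N) (f : Module.Dual k C) {x : C} (hx : x ∈ N) :
    leftHit f x ∈ N :=
  isRightCoideal_iff.1 hN f x hx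

theorem sup (hN : IsRightCoideal k C N) (hL : IsRightCoideal k C L) : IsRightCoideal k C (N ⊔ L) :=
  (rightCoideals k C).supClosed hN hL

theorem inf (hN : IsRightCoideal k C N) (hL : IsRightCoideal k C L) : IsRightCoideal k C (N ⊓ L) :=
  (rightCoideals k C).infClosed hN hL

theorem map {T : Module.End k C} (hN : IsRightCoideal k C N) (hT : IsColinear T) :
    IsRightCoideal k C (N.map T) := by
  rw [isRightCoideal_iff]
  rintro f _ ⟨x, hx, rfl⟩
  exact ⟨_, hN.leftHit_mem f hx, hT.map_leftHit f x⟩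

theorem comap {T : Module.End k C} (hN : IsRightCoideal k C N) (hT : IsColinear T) :
    IsRightCoideal k C (N.comap T) := by
  rw [isRightCoideal_iff]
  intro f x hx
  rw [Submodule.mem_comap, hT.map_leftHit]
  exact hN.leftHit_mem f hx

theorem rightCoidealSpan_le (hN : IsRightCoideal k C N) {x : C} (hx : x ∈ N) :
    rightCoidealSpan x ≤ N := by
  rintro _ ⟨f, rfl⟩
  exact hN.leftHit_mem f hx

theorem le_ker_rightHit (hN : IsRightCoideal k C N) {f : Module.Dual k C}
    (hf : N ≤ LinearMap.ker f) : N ≤ LinearMap.ker (rightHit f) := by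
  intro x hx
  rw [LinearMap.mem_ker, ← Module.forall_dual_apply_eq_zero_iff k]
  intro g
  rw [apply_rightHit]
  exact hf (hN.leftHit_mem g hx)

theorem exists_counit_eq_one (hN : IsRightCoideal k C N) (h0 : N ≠ ⊥) :
    ∃ x ∈ N, counit (R := k) x = 1 := by
  obtain ⟨y, hy, hy0⟩ := Submodule.exists_mem_ne_zero_of_ne_bot h0
  obtain ⟨f, hf⟩ := Module.Projective.exists_dual_ne_zero k hy0
  exact ⟨leftHit ((f y)⁻¹ • f) y, hN.leftHit_mem _ hy, by simp [hf]⟩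

/-- Induction along images: a finite-dimensional right coideal is reduced to a smaller one by any
colinear map with a nonzero kernel on it. -/
theorem induction_on_map {P : Submodule k C → Prop} (bot : P ⊥)
    (step : ∀ N, IsRightCoideal k C N → N ≠ ⊥ →
      ∃ T : Module.End k C, IsColinear T ∧ N ⊓ LinearMap.ker T ≠ ⊥ ∧ (P (N.map T) → P N))
    [Module.Finite k N] (hN : IsRightCoideal k C N) : P N := by
  induction h : Module.finrank k N using Nat.strong_induction_on generalizing N with
  | _ n ih =>
    obtain rfl | h0 := eq_or_ne N ⊥
    · exact bot
    obtain ⟨T, hT, hker, hP⟩ := step N hN h0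
    exact hP (ih _ (h ▸ finrank_map_lt_of_inf_ker_ne_bot hker) (hN.map hT) rfl)

end IsRightCoideal

theorem IsColinear.isRightCoideal_ker {T : Module.End k C} (hT : IsColinear T) :
    IsRightCoideal k C (LinearMap.ker T) :=
  isRightCoideal_bot.comap hT

/-- Simple objects among the right coideals: the minimal nonzero ones. -/
def IsSimpleRightCoideal (S : Submodule k C) : Prop :=
  Minimal (fun N ↦ IsRightCoideal k C N ∧ N ≠ ⊥) S

theorem IsRightCoideal.exists_isSimpleRightCoideal_le {N : Submodule k C}
    (hN : IsRightCoideal k C N) (h0 : N ≠ ⊥) :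
    ∃ S ≤ N, Module.Finite k S ∧ IsSimpleRightCoideal S := by
  obtain ⟨x, hx, hx0⟩ := Submodule.exists_mem_ne_zero_of_ne_bot h0
  have hspan : rightCoidealSpan (k := k) x ≠ ⊥ :=
    (Submodule.ne_bot_iff _).2 ⟨x, mem_rightCoidealSpan_self x, hx0⟩
  obtain ⟨S, hS, hfin, hmin⟩ := exists_minimal_le_of_finite
    (P := fun N ↦ IsRightCoideal k C N ∧ N ≠ ⊥) ⟨isRightCoideal_rightCoidealSpan x, hspan⟩
  exact ⟨S, hS.trans (hN.rightCoidealSpan_le hx), hfin, hmin⟩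

end RightCoideals

section TensorSubmodules

variable {k V W : Type*} [Field k] [AddCommGroup V] [Module k V] [AddCommGroup W] [Module k W]

theorem mem_range_lTensor_iff (N : Submodule k W) (z : V ⊗[k] W) :
    z ∈ LinearMap.range (N.subtype.lTensor V) ↔
      ∀ f : Module.Dual k V, TensorProduct.lid k W (f.rTensor W z) ∈ N := by
  have hslice (f : Module.Dual k V) : TensorProduct.rid k W
      (f.lTensor W (TensorProduct.comm k V W z)) = TensorProduct.lid k W (f.rTensor W z) := by
    rw [LinearMap.lTensor_comm, TensorProduct.rid_comm]
  simp_rw [← hslice, ← CoalgTensor.mem_range_rTensor_iff]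
  constructor
  · rintro ⟨t, rfl⟩
    exact ⟨TensorProduct.comm k V N t, LinearMap.rTensor_comm _ _⟩
  · rintro ⟨t, ht⟩
    exact ⟨TensorProduct.comm k N V t, by simp [LinearMap.lTensor_comm, ht]⟩

theorem mem_range_map_subtype {N : Submodule k V} {L : Submodule k W} {z : V ⊗[k] W}
    (hN : z ∈ LinearMap.range (N.subtype.rTensor W))
    (hL : z ∈ LinearMap.range (L.subtype.lTensor V)) :
    z ∈ LinearMap.range (TensorProduct.map N.subtype L.subtype) := by
  obtain ⟨t, rfl⟩ := hN
  obtain ⟨s, hs⟩ := hL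
  obtain ⟨π, hπ⟩ := L.subtype.exists_leftInverse_of_injective L.ker_subtype
  refine ⟨π.lTensor N t, ?_⟩
  calc TensorProduct.map N.subtype L.subtype (π.lTensor N t)
      = (L.subtype ∘ₗ π).lTensor V (N.subtype.rTensor W t) := by
        simp only [← LinearMap.comp_apply, LinearMap.lTensor_comp_rTensor,
          LinearMap.map_comp_lTensor]
    _ = (L.subtype ∘ₗ π ∘ₗ L.subtype).lTensor V s := by
        simp only [← hs, ← LinearMap.comp_apply, ← LinearMap.lTensor_comp, LinearMap.comp_assoc]
    _ = N.subtype.rTensor W t := by rw [hπ, LinearMap.comp_id, hs]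

end TensorSubmodules

section Subcoalgebras

variable {k C : Type*} [Field k] [AddCommGroup C] [Module k C] [Coalgebra k C]

/-- A subspace stable under both hit actions, regarded as a subcoalgebra. -/
def Subcoalgebra.ofStable (N : Submodule k C) (hN : IsRightCoideal k C N)
    (hright : ∀ f : Module.Dual k C, ∀ x ∈ N, rightHit f x ∈ N) : Subcoalgebra k C where
  toSubmodule := N
  comul_mem' x hx :=
    mem_range_map_subtype (hN x hx) ((mem_range_lTensor_iff _ _).2 fun f ↦ hright f x hx)

theorem Subcoalgebra.isRightCoideal (D : Subcoalgebra k C) :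
    IsRightCoideal k C D.toSubmodule := by
  intro x hx
  obtain ⟨t, ht⟩ := D.comul_mem' x hx
  refine ⟨D.toSubmodule.subtype.lTensor _ t, ?_⟩
  rw [← ht, ← LinearMap.comp_apply, LinearMap.rTensor_comp_lTensor]

end Subcoalgebras

section GroupLike

variable {k C : Type*} [Field k] [AddCommGroup C] [Module k C] [Coalgebra k C]

theorem leftHit_of_isGroupLikeElem {g : C} (hg : IsGroupLikeElem k g) (f : Module.Dual k C) :
    leftHit f g = f g • g := by
  simp [leftHit_apply, hg.comul_eq_tmul_self]

theorem rightHit_of_isGroupLikeElem {g : C} (hg : IsGroupLikeElem k g) (f : Module.Dual k C) :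
    rightHit f g = f g • g := by
  simp [rightHit_apply, hg.comul_eq_tmul_self]

/-- The subcoalgebra spanned by a group-like element. -/
def Subcoalgebra.spanGroupLike {g : C} (hg : IsGroupLikeElem k g) : Subcoalgebra k C :=
  .ofStable (k ∙ g)
    (by
      simp only [isRightCoideal_iff, Submodule.mem_span_singleton]
      rintro f _ ⟨a, rfl⟩
      exact ⟨a * f g, by simp [leftHit_of_isGroupLikeElem hg, mul_smul]⟩)
    (by
      simp only [Submodule.mem_span_singleton]
      rintro f _ ⟨a, rfl⟩
      exact ⟨a * f g, by simp [rightHit_of_isGroupLikeElem hg, mul_smul]⟩)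

theorem isRightCoideal_span_singleton {g : C} (hg : IsGroupLikeElem k g) :
    IsRightCoideal k C (k ∙ g) :=
  (Subcoalgebra.spanGroupLike hg).isRightCoideal

theorem eq_of_mem_span_singleton_of_isGroupLikeElem {g h : C} (hg : IsGroupLikeElem k g)
    (hh : IsGroupLikeElem k h) (hmem : h ∈ k ∙ g) : h = g := by
  obtain ⟨a, rfl⟩ := Submodule.mem_span_singleton.1 hmem
  have ha : a = 1 := by simpa [hg.counit_eq_one] using hh.counit_eq_one
  rw [ha, one_smul]

namespace IsRightCoideal

theorem isGroupLikeElem {g : C} (hg : IsRightCoideal k C (k ∙ g))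
    (hcounit : counit (R := k) g = 1) : IsGroupLikeElem k g where
  counit_eq_one := hcounit
  comul_eq_tmul_self := by
    let P := LinearMap.toSpanSingleton k C g ∘ₗ counit (R := k) (A := C)
    have hP : P ∘ₗ (k ∙ g).subtype = (k ∙ g).subtype := by
      refine LinearMap.ext fun ⟨y, hy⟩ ↦ ?_
      obtain ⟨a, rfl⟩ := Submodule.mem_span_singleton.1 hy
      simp [P, hcounit]
    obtain ⟨t, ht⟩ := hg g (Submodule.mem_span_singleton_self g)
    calc comul g = P.rTensor C (comul g) := by
          rw [← ht, ← LinearMap.comp_apply, ← LinearMap.rTensor_comp, hP]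
      _ = g ⊗ₜ g := by simp [P, LinearMap.rTensor_comp]

theorem exists_isGroupLikeElem_of_finrank_eq_one {N : Submodule k C} (hN : IsRightCoideal k C N)
    (hrank : Module.finrank k N = 1) : ∃ g ∈ N, IsGroupLikeElem k g := by
  have h0 : N ≠ ⊥ := by rintro rfl; simp at hrank
  obtain ⟨g, hg, hcounit⟩ := hN.exists_counit_eq_one h0
  have hspan : k ∙ g = N := by
    have : Module.Finite k N := Module.finite_of_finrank_eq_succ hrank
    refine Submodule.eq_of_le_of_finrank_eq ((Submodule.span_singleton_le_iff_mem _ _).2 hg) ?_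
    rw [hrank, finrank_span_singleton]
    rintro rfl
    simp at hcounit
  exact ⟨g, hg, (hspan ▸ hN).isGroupLikeElem hcounit⟩

end IsRightCoideal

variable (k C) in
/-- A coalgebra is right pointed if every nonzero right coideal contains a group-like element,
that is, if its simple right subcomodules are all one-dimensional. -/
def IsRightPointed : Prop :=
  ∀ N : Submodule k C, IsRightCoideal k C N → N ≠ ⊥ → ∃ g ∈ N, IsGroupLikeElem k g

theorem IsRightPointed.isPointedCoalgebra (hC : IsRightPointed k C) : IsPointedCoalgebra k C := by
  rintro D ⟨h0, hD⟩
  obtain ⟨g, hgD, hg⟩ := hC _ D.isRightCoideal h0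
  have hspan : k ∙ g = D.toSubmodule :=
    (hD (.spanGroupLike hg) ((Submodule.span_singleton_le_iff_mem _ _).2 hgD)).resolve_left
      (Submodule.span_singleton_eq_bot.not.2 hg.ne_zero)
  rw [← hspan, finrank_span_singleton hg.ne_zero]

end GroupLike

section Distributive

variable {k C : Type*} [Field k] [AddCommGroup C] [Module k C] [Coalgebra k C]

theorem IsChainCoalgebra.isDistributiveCoalgebra (hC : IsChainCoalgebra k C) :
    IsDistributiveCoalgebra k C := by
  intro N L M
  obtain h | h := hC.le_or_le L M
  · rw [sup_eq_right.2 h, sup_eq_right.2 (inf_le_inf_left N h)]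
  · rw [sup_eq_left.2 h, sup_eq_left.2 (inf_le_inf_left N h)]

theorem IsRightCoideal.fiberSum {X Y : Submodule k C} {u v : Module.End k C}
    (hX : IsRightCoideal k C X) (hY : IsRightCoideal k C Y) (hu : IsColinear u)
    (hv : IsColinear v) : IsRightCoideal k C (fiberSum X Y u v) := by
  simp only [isRightCoideal_iff, mem_fiberSum]
  rintro f _ ⟨x, hx, y, hy, h, rfl⟩
  exact ⟨_, hX.leftHit_mem f hx, _, hY.leftHit_mem f hy,
    by rw [hu.map_leftHit, h, hv.map_leftHit], (map_add _ _ _).symm⟩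

namespace IsDistributiveCoalgebra

theorem inf_sup_eq (hC : IsDistributiveCoalgebra k C) {N L M : Submodule k C}
    (hN : IsRightCoideal k C N) (hL : IsRightCoideal k C L) (hM : IsRightCoideal k C M) :
    N ⊓ (L ⊔ M) = (N ⊓ L) ⊔ (N ⊓ M) :=
  congrArg Subtype.val (hC ⟨N, hN⟩ ⟨L, hL⟩ ⟨M, hM⟩)

/-- A common subquotient of `X / (X ⊓ Y)` and `Y / (X ⊓ Y)` would produce a diagonal in the
lattice of right coideals, and distributive lattices contain no diagonals. -/
theorem map_inf_map_eq_bot (hC : IsDistributiveCoalgebra k C) {X Y : Submodule k C}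
    {u v : Module.End k C} (hX : IsRightCoideal k C X) (hY : IsRightCoideal k C Y)
    (hu : IsColinear u) (hv : IsColinear v) (hXu : X ⊓ Y ≤ LinearMap.ker u)
    (hXv : X ⊓ Y ≤ LinearMap.ker v) : X.map u ⊓ Y.map v = ⊥ := by
  rw [eq_bot_iff]
  rintro _ ⟨⟨x, hx, rfl⟩, y, hy, hxy⟩
  have hmem : x + y ∈ fiberSum X Y u v ⊓ (X ⊔ Y) :=
    ⟨mem_fiberSum.2 ⟨x, hx, y, hy, hxy.symm, rfl⟩, Submodule.add_mem_sup hx hy⟩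
  rw [hC.inf_sup_eq (hX.fiberSum hY hu hv) hX hY] at hmem
  obtain ⟨x', ⟨hx'D, hx'⟩, y', ⟨-, hy'⟩, hsum⟩ := Submodule.mem_sup.1 hmem
  have hker : u x' = 0 := by
    obtain ⟨a, ha, b, hb, hab, rfl⟩ := mem_fiberSum.1 hx'D
    have hb : b ∈ X ⊓ Y := ⟨(X.add_mem_iff_right ha).1 hx', hb⟩
    rw [map_add, hab, hXv hb, hXu hb, add_zero]
  have hdiff : x - x' ∈ X ⊓ Y := by
    refine ⟨X.sub_mem hx hx', ?_⟩
    rw [show x - x' = y' - y by rw [sub_eq_sub_iff_add_eq_add, ← hsum, add_comm]]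
    exact Y.sub_mem hy' hy
  have : u x - u x' = 0 := by rw [← map_sub, hXu hdiff]
  rwa [hker, sub_zero] at this

end IsDistributiveCoalgebra

namespace IsSimpleRightCoideal

variable {S N : Submodule k C}

theorem le_of_inf_ne_bot (hS : IsSimpleRightCoideal S) (hN : IsRightCoideal k C N)
    (h : S ⊓ N ≠ ⊥) : S ≤ N :=
  (hS.le_of_le ⟨hS.prop.1.inf hN, h⟩ inf_le_left).trans inf_le_right

theorem rightHit_mem (hS : IsSimpleRightCoideal S) [Module.Finite k S]
    (hC : IsDistributiveCoalgebra k C) (f : Module.Dual k C) {x : C} (hx : x ∈ S) :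
    rightHit f x ∈ S := by
  suffices h : S.map (rightHit f) ≤ S from h ⟨x, hx, rfl⟩
  have hmap := hS.prop.1.map (isColinear_rightHit f)
  by_cases hinf : S ⊓ S.map (rightHit f) = ⊥
  · have := hC.map_inf_map_eq_bot hS.prop.1 hmap (isColinear_rightHit f) .one
      (hinf ▸ bot_le) (hinf ▸ bot_le)
    rw [Module.End.one_eq_id, Submodule.map_id, inf_idem] at this
    exact this ▸ bot_le
  · exact (Submodule.eq_of_le_of_finrank_le (hS.le_of_inf_ne_bot hmap hinf)
      (Submodule.finrank_map_le _ _)).ge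

theorem exists_forall_apply_eq_mul_counit [IsAlgClosed k] [Module.Finite k S]
    (hS : IsSimpleRightCoideal S) (f : Module.Dual k C)
    (hstable : ∀ x ∈ S, rightHit f x ∈ S) :
    ∃ a : k, ∀ x ∈ S, f x = a * counit (R := k) x := by
  have : Nontrivial S := Submodule.nontrivial_iff_ne_bot.2 hS.prop.2
  obtain ⟨a, ha⟩ := Module.End.exists_eigenvalue ((rightHit f).restrict hstable)
  obtain ⟨s, hs⟩ := ha.exists_hasEigenvector
  have hs' : rightHit f (s : C) = a • (s : C) := congrArg Subtype.val hs.apply_eq_smul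
  have hker : S ≤ LinearMap.ker (rightHit (f - a • counit)) := by
    refine hS.le_of_inf_ne_bot (isColinear_rightHit _).isRightCoideal_ker ?_
    refine (Submodule.ne_bot_iff _).2 ⟨s, ⟨s.2, ?_⟩, fun h ↦ hs.2 (Subtype.ext h)⟩
    simp [hs']
  refine ⟨a, fun x hx ↦ ?_⟩
  have := congrArg (counit (R := k)) (hker hx)
  simpa [sub_eq_zero] using this

theorem finrank_eq_one [IsAlgClosed k] [Module.Finite k S] (hS : IsSimpleRightCoideal S)
    (hstable : ∀ f : Module.Dual k C, ∀ x ∈ S, rightHit f x ∈ S) : Module.finrank k S = 1 := by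
  obtain ⟨x, hx, hcounit⟩ := hS.prop.1.exists_counit_eq_one hS.prop.2
  have hx0 : x ≠ 0 := by rintro rfl; simp at hcounit
  refine _root_.finrank_eq_one ⟨x, hx⟩ (by simpa using hx0) fun ⟨y, hy⟩ ↦ ⟨counit y, Subtype.ext ?_⟩
  refine sub_eq_zero.1 ((Module.forall_dual_apply_eq_zero_iff k _).1 fun f ↦ ?_)
  obtain ⟨a, ha⟩ := hS.exists_forall_apply_eq_mul_counit f (hstable f)
  simp [ha, hx, hy, hcounit, mul_comm]

end IsSimpleRightCoideal

theorem Subcoalgebra.isSimple_of_isSimpleRightCoideal {D : Subcoalgebra k C}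
    (hD : IsSimpleRightCoideal D.toSubmodule) : D.IsSimple :=
  ⟨hD.prop.2, fun E hE ↦ or_iff_not_imp_left.2 fun h0 ↦
    hD.eq_of_le ⟨E.isRightCoideal, h0⟩ hE⟩

namespace IsDistributiveCoalgebra

theorem isRightPointed (hC : IsDistributiveCoalgebra k C) (hpointed : IsPointedCoalgebra k C) :
    IsRightPointed k C := by
  intro N hN h0
  obtain ⟨S, hSN, _, hS⟩ := hN.exists_isSimpleRightCoideal_le h0
  let D := Subcoalgebra.ofStable S hS.prop.1 fun f x ↦ hS.rightHit_mem hC f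
  have hD : D.IsSimple := Subcoalgebra.isSimple_of_isSimpleRightCoideal hS
  obtain ⟨g, hgS, hg⟩ := hS.prop.1.exists_isGroupLikeElem_of_finrank_eq_one (hpointed D hD)
  exact ⟨g, hSN hgS, hg⟩

theorem isPointedCoalgebra_of_isAlgClosed [IsAlgClosed k] (hC : IsDistributiveCoalgebra k C) :
    IsPointedCoalgebra k C := by
  rintro D ⟨h0, hD⟩
  obtain ⟨S, hSD, _, hS⟩ := D.isRightCoideal.exists_isSimpleRightCoideal_le h0
  have hstable (f : Module.Dual k C) (x : C) (hx : x ∈ S) : rightHit f x ∈ S :=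
    hS.rightHit_mem hC f hx
  have hSD : S = D.toSubmodule :=
    (hD (.ofStable S hS.prop.1 hstable) hSD).resolve_left hS.prop.2
  rw [← hSD, hS.finrank_eq_one hstable]

end IsDistributiveCoalgebra

end Distributive

section CoalgHoms

theorem leftHit_coalgHom {R C E : Type*} [CommSemiring R] [AddCommMonoid C] [Module R C]
    [Coalgebra R C] [AddCommMonoid E] [Module R E] [Coalgebra R E] (φ : C →ₗc[R] E)
    (f : Module.Dual R E) (x : C) :
    leftHit f (φ x) = φ (leftHit (f ∘ₗ φ.toLinearMap) x) := by
  rw [leftHit_apply, ← CoalgHomClass.map_comp_comul_apply, leftHit_eq_sum _ (ℛ R x)]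
  conv_lhs => rw [← (ℛ R x).eq]
  simp

variable {k C D E : Type*} [Field k] [AddCommGroup C] [Module k C] [Coalgebra k C]
  [AddCommGroup D] [Module k D] [Coalgebra k D] [AddCommGroup E] [Module k E] [Coalgebra k E]

section Transfer

variable {φ : C →ₗc[k] E}

theorem isRightCoideal_map_coalgHom_iff (hφ : Function.Injective φ) {N : Submodule k C} :
    IsRightCoideal k E (N.map φ.toLinearMap) ↔ IsRightCoideal k C N := by
  rw [isRightCoideal_iff, isRightCoideal_iff]
  constructor
  · intro h f x hx
    obtain ⟨f, rfl⟩ := LinearMap.dualMap_surjective_of_injective (f := φ.toLinearMap) hφ f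
    obtain ⟨y, hy, hyx⟩ := h f (φ x) ⟨x, hx, rfl⟩
    rw [leftHit_coalgHom] at hyx
    exact (hφ hyx) ▸ hy
  · rintro h f _ ⟨x, hx, rfl⟩
    exact ⟨_, h _ x hx, (leftHit_coalgHom φ f x).symm⟩

theorem IsRightCoideal.comap_coalgHom {N : Submodule k E} (hN : IsRightCoideal k E N)
    (hφ : Function.Injective φ) : IsRightCoideal k C (N.comap φ.toLinearMap) := by
  rw [isRightCoideal_iff]
  intro f x hx
  obtain ⟨f, rfl⟩ := LinearMap.dualMap_surjective_of_injective (f := φ.toLinearMap) hφ f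
  exact (leftHit_coalgHom φ f x ▸ hN.leftHit_mem f hx : φ _ ∈ N)

theorem isGroupLikeElem_coalgHom_iff (hφ : Function.Injective φ) {g : C} :
    IsGroupLikeElem k (φ g) ↔ IsGroupLikeElem k g := by
  refine ⟨fun hg ↦ ⟨?_, ?_⟩, fun hg ↦ hg.map φ⟩
  · rw [← CoalgHomClass.counit_comp_apply φ, hg.counit_eq_one]
  · refine TensorProduct.map_injective_of_flat_flat φ.toLinearMap φ.toLinearMap hφ hφ ?_
    rw [TensorProduct.map_tmul]
    exact (CoalgHomClass.map_comp_comul_apply φ g).trans hg.comul_eq_tmul_self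

theorem IsRightPointed.of_injective (hE : IsRightPointed k E) (hφ : Function.Injective φ) :
    IsRightPointed k C := by
  intro N hN h0
  obtain ⟨_, ⟨g, hgN, rfl⟩, hg⟩ := hE _ ((isRightCoideal_map_coalgHom_iff hφ).2 hN)
    (by simpa using (Submodule.map_injective_of_injective (f := φ.toLinearMap) hφ).ne h0)
  exact ⟨g, hgN, (isGroupLikeElem_coalgHom_iff hφ).1 hg⟩

theorem IsDistributiveCoalgebra.of_injective (hE : IsDistributiveCoalgebra k E)
    (hφ : Function.Injective φ) : IsDistributiveCoalgebra k C := by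
  rintro ⟨N, hN⟩ ⟨L, hL⟩ ⟨M, hM⟩
  refine Subtype.ext (Submodule.map_injective_of_injective (f := φ.toLinearMap) hφ ?_)
  change Submodule.map _ (N ⊓ (L ⊔ M)) = Submodule.map _ ((N ⊓ L) ⊔ (N ⊓ M))
  simp only [Submodule.map_inf _ hφ, Submodule.map_sup]
  exact hE.inf_sup_eq ((isRightCoideal_map_coalgHom_iff hφ).2 hN)
    ((isRightCoideal_map_coalgHom_iff hφ).2 hL) ((isRightCoideal_map_coalgHom_iff hφ).2 hM)

theorem IsChainCoalgebra.of_injective_of_comparable [Nontrivial C] (hφ : Function.Injective φ)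
    (hE : ∀ N ≤ LinearMap.range φ.toLinearMap, ∀ L ≤ LinearMap.range φ.toLinearMap,
      IsRightCoideal k E N → IsRightCoideal k E L → N ≤ L ∨ L ≤ N) : IsChainCoalgebra k C where
  nontrivial := ‹_›
  le_or_le := by
    rintro ⟨N, hN⟩ ⟨L, hL⟩
    exact (hE _ LinearMap.map_le_range _ LinearMap.map_le_range
      ((isRightCoideal_map_coalgHom_iff hφ).2 hN) ((isRightCoideal_map_coalgHom_iff hφ).2 hL)).imp
      (Submodule.map_le_map_iff_of_injective hφ _ _).1
      (Submodule.map_le_map_iff_of_injective hφ _ _).1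

theorem IsChainCoalgebra.of_injective [Nontrivial C] (hE : IsChainCoalgebra k E)
    (hφ : Function.Injective φ) : IsChainCoalgebra k C :=
  .of_injective_of_comparable hφ fun N _ L _ hN hL ↦ hE.le_or_le ⟨N, hN⟩ ⟨L, hL⟩

end Transfer

namespace Subcoalgebra

/-- The inclusion of a subcoalgebra, as a coalgebra homomorphism. -/
def subtype (S : Subcoalgebra k C) : S.toSubmodule →ₗc[k] C where
  toLinearMap := S.toSubmodule.subtype
  counit_comp := rfl
  map_comp_comul := S.map_subtype_comp_comulAux

theorem subtype_injective (S : Subcoalgebra k C) : Function.Injective S.subtype :=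
  S.toSubmodule.injective_subtype

/-- The image of a coalgebra homomorphism, as a subcoalgebra of the target. -/
def range (φ : C →ₗc[k] E) : Subcoalgebra k E where
  toSubmodule := LinearMap.range φ.toLinearMap
  comul_mem' := by
    rintro _ ⟨x, rfl⟩
    refine ⟨TensorProduct.map φ.toLinearMap.rangeRestrict φ.toLinearMap.rangeRestrict
      (comul x), ?_⟩
    rw [← LinearMap.comp_apply, ← TensorProduct.map_comp, LinearMap.subtype_comp_codRestrict]
    exact CoalgHomClass.map_comp_comul_apply φ x

/-- A coalgebra homomorphism with image in a subcoalgebra, with its target restricted. -/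
def codRestrict (S : Subcoalgebra k E) (φ : C →ₗc[k] E) (hφ : ∀ x, φ x ∈ S.toSubmodule) :
    C →ₗc[k] S.toSubmodule where
  toLinearMap := φ.toLinearMap.codRestrict S.toSubmodule hφ
  counit_comp := φ.counit_comp
  map_comp_comul := by
    refine LinearMap.ext fun x ↦ S.map_subtype_injective ?_
    rw [← LinearMap.comp_apply, ← LinearMap.comp_assoc, ← TensorProduct.map_comp]
    exact (CoalgHomClass.map_comp_comul_apply φ x).trans (S.map_subtype_comulAux ⟨φ x, hφ x⟩).symm

end Subcoalgebra

theorem nonempty_coalgEquiv_range {φ : C →ₗc[k] E} (hφ : Function.Injective φ) :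
    Nonempty (C ≃ₗc[k] (Subcoalgebra.range φ).toSubmodule) :=
  ⟨.ofBijective (f := (Subcoalgebra.range φ).codRestrict φ fun x ↦ ⟨x, rfl⟩)
    ⟨fun _ _ h ↦ hφ (congrArg Subtype.val h), fun ⟨_, x, hx⟩ ↦ ⟨x, Subtype.ext hx⟩⟩⟩

theorem nonempty_coalgEquiv_of_range_eq {φ : C →ₗc[k] E} {ψ : D →ₗc[k] E}
    (hφ : Function.Injective φ) (hψ : Function.Injective ψ)
    (h : LinearMap.range φ.toLinearMap = LinearMap.range ψ.toLinearMap) :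
    Nonempty (C ≃ₗc[k] D) := by
  have hrange : Subcoalgebra.range φ = Subcoalgebra.range ψ := by
    simp only [Subcoalgebra.range, h]
  obtain ⟨e⟩ := nonempty_coalgEquiv_range hφ
  obtain ⟨e'⟩ := nonempty_coalgEquiv_range hψ
  rw [hrange] at e
  exact ⟨e.trans e'.symm⟩

theorem exists_nonempty_coalgEquiv_subcoalgebra_iff :
    (∃ S : Subcoalgebra k E, S.toSubmodule ≠ ⊥ ∧ Nonempty (C ≃ₗc[k] S.toSubmodule)) ↔
      Nontrivial C ∧ ∃ φ : C →ₗc[k] E, Function.Injective φ := by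
  constructor
  · rintro ⟨S, hS, ⟨e⟩⟩
    have : Nontrivial S.toSubmodule := Submodule.nontrivial_iff_ne_bot.2 hS
    exact ⟨e.toEquiv.nontrivial, S.subtype.comp e.toCoalgHom,
      S.subtype_injective.comp e.toEquiv.injective⟩
  · rintro ⟨_, φ, hφ⟩
    obtain ⟨e⟩ := nonempty_coalgEquiv_range hφ
    exact ⟨.range φ, Submodule.nontrivial_iff_ne_bot.1 e.symm.toEquiv.nontrivial, ⟨e⟩⟩

end CoalgHoms

namespace DividedPower

variable {k : Type u} [Field k]

theorem tensorProduct_repr_comul (y : DividedPower k) (i j : ℕ) :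
    ((c k).tensorProduct (c k)).repr (comul y) (i, j) = (c k).repr y (i + j) := by
  let b := (c k).tensorProduct (c k)
  suffices h : b.coord (i, j) ∘ₗ comul = (c k).coord (i + j) from LinearMap.congr_fun h y
  refine (c k).ext fun n ↦ ?_
  have hb (p : ℕ × ℕ) : b.repr (c k p.1 ⊗ₜ c k p.2) = Finsupp.single p 1 := by
    rw [← Module.Basis.tensorProduct_apply', Module.Basis.repr_self]
  simp [comul_c, hb, Finsupp.single_apply, eq_comm]

theorem counit_eq_repr_zero (y : DividedPower k) : counit (R := k) y = (c k).repr y 0 := by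
  suffices h : counit = (c k).coord 0 from LinearMap.congr_fun h y
  refine (c k).ext fun n ↦ ?_
  simp [counit_c, Finsupp.single_apply]

section Lift

variable {C : Type*} [AddCommGroup C] [Module k C] [Coalgebra k C] {T : Module.End k C}

theorem finite_support_counit_pow {x : C} (hx : ∃ n, (T ^ n) x = 0) :
    (Function.support fun n ↦ counit (R := k) ((T ^ n) x)).Finite := by
  obtain ⟨m, hm⟩ := hx
  refine (Set.finite_Iio m).subset fun n hn ↦ ?_
  by_contra hmn
  exact hn (by simp [Module.End.pow_map_zero_of_le (not_lt.1 hmn) hm])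

/-- The linear map `x ↦ ∑ₙ ε(Tⁿ x) cₙ` for a locally nilpotent endomorphism `T`. -/
noncomputable def liftLinear (T : Module.End k C) (hnil : ∀ x, ∃ n, (T ^ n) x = 0) :
    C →ₗ[k] DividedPower k where
  toFun x := (c k).repr.symm (.ofSupportFinite _ (finite_support_counit_pow (hnil x)))
  map_add' x y := (c k).repr.injective (by ext; simp [Finsupp.ofSupportFinite_coe])
  map_smul' a x := (c k).repr.injective (by ext; simp [Finsupp.ofSupportFinite_coe])

@[simp]
theorem repr_liftLinear (hnil : ∀ x, ∃ n, (T ^ n) x = 0) (x : C) (n : ℕ) :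
    (c k).repr (liftLinear T hnil x) n = counit (R := k) ((T ^ n) x) := by
  simp [liftLinear, Finsupp.ofSupportFinite_coe]

theorem tensorProduct_repr_map_liftLinear (hT : IsColinear T) (hnil : ∀ x, ∃ n, (T ^ n) x = 0)
    (x : C) (i j : ℕ) :
    ((c k).tensorProduct (c k)).repr
      (TensorProduct.map (liftLinear T hnil) (liftLinear T hnil) (comul x)) (i, j) =
        counit (R := k) ((T ^ (i + j)) x) := by
  calc _ = counit (R := k) ((T ^ i) (leftHit (counit ∘ₗ T ^ j) x)) := by
        conv_lhs => rw [← (ℛ k x).eq]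
        simp [leftHit_eq_sum _ (ℛ k x), Finsupp.finsetSum_apply, mul_comm]
    _ = counit (R := k) ((T ^ (i + j)) x) := by
        rw [(hT.pow i).map_leftHit, counit_leftHit, add_comm, pow_add]
        rfl

/-- The coalgebra homomorphism `x ↦ ∑ₙ ε(Tⁿ x) cₙ` to the divided power coalgebra for a locally
nilpotent colinear endomorphism `T`; it intertwines `T` with the shift `cₙ₊₁ ↦ cₙ`. -/
noncomputable def lift (T : Module.End k C) (hT : IsColinear T)
    (hnil : ∀ x, ∃ n, (T ^ n) x = 0) : C →ₗc[k] DividedPower k where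
  toLinearMap := liftLinear T hnil
  counit_comp := LinearMap.ext fun x ↦ by simp [counit_eq_repr_zero]
  map_comp_comul := by
    refine LinearMap.ext fun x ↦ ((c k).tensorProduct (c k)).repr.injective ?_
    ext ⟨i, j⟩
    simp [tensorProduct_repr_map_liftLinear hT, tensorProduct_repr_comul]

theorem lift_injective (hT : IsColinear T) (hnil : ∀ x, ∃ n, (T ^ n) x = 0)
    (hker : LinearMap.ker T ⊓ LinearMap.ker (counit (R := k) (A := C)) = ⊥) :
    Function.Injective (lift T hT hnil) := by
  rw [injective_iff_map_eq_zero]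
  intro x hx
  have hcounit (n : ℕ) : counit (R := k) ((T ^ n) x) = 0 := by
    rw [← repr_liftLinear hnil]
    exact congr((c k).repr $hx n).trans (by simp)
  obtain ⟨n, hn⟩ := hnil x
  induction n with
  | zero => simpa using hn
  | succ n ih =>
    refine ih ((Submodule.eq_bot_iff _).1 hker _ ⟨?_, hcounit n⟩)
    change (T * T ^ n) x = 0
    rwa [← pow_succ']

end Lift

section RightCoideals

theorem repr_leftHit_coord (m : ℕ) (y : DividedPower k) (i : ℕ) :
    (c k).repr (leftHit ((c k).coord m) y) i = (c k).repr y (i + m) := by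
  rw [← tensorProduct_repr_comul, leftHit_eq_sum _ (ℛ k y), ← (ℛ k y).eq]
  simp [Finsupp.finsetSum_apply]

theorem mem_of_forall_c_mem {N : Submodule k (DividedPower k)} {y : DividedPower k}
    (h : ∀ i, (c k).repr y i ≠ 0 → c k i ∈ N) : y ∈ N := by
  rw [← (c k).linearCombination_repr y, Finsupp.linearCombination_apply]
  exact N.sum_smul_mem _ fun i hi ↦ h i (Finsupp.mem_support_iff.1 hi)

variable {N L : Submodule k (DividedPower k)}

theorem c_mem_of_forall_repr_eq_zero (hN : IsRightCoideal k _ N) {n : ℕ} {y : DividedPower k}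
    (hy : y ∈ N) (hn : (c k).repr y n ≠ 0) (htop : ∀ m, n < m → (c k).repr y m = 0) {i : ℕ}
    (hi : i ≤ n) : c k i ∈ N := by
  induction n generalizing y i with
  | zero =>
    have : y = (c k).repr y 0 • c k 0 := by
      refine (c k).ext_elem fun j ↦ ?_
      obtain rfl | hj := j.eq_zero_or_pos
      · simp
      · simp [htop j hj, hj.ne]
    obtain rfl := Nat.le_zero.1 hi
    exact (N.smul_mem_iff hn).1 (this ▸ hy)
  | succ n ih =>
    have hlow {j : ℕ} (hj : j ≤ n) : c k j ∈ N := by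
      refine ih (hN.leftHit_mem ((c k).coord 1) hy) ?_ (fun m hm ↦ ?_) hj <;>
        rw [repr_leftHit_coord]
      exacts [hn, htop _ (by lia)]
    obtain hi | rfl := Nat.le_succ_iff.1 hi
    · exact hlow hi
    have hdiff : y - (c k).repr y (n + 1) • c k (n + 1) ∈ N := by
      refine mem_of_forall_c_mem fun j hj ↦ hlow ?_
      contrapose! hj
      obtain rfl | hj := (Nat.succ_le_iff.2 hj).eq_or_lt
      · simp
      · simp [htop j hj, hj.ne]
    exact (N.smul_mem_iff hn).1 ((N.sub_mem_iff_right hy).1 hdiff)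

theorem c_mem_of_repr_ne_zero (hN : IsRightCoideal k _ N) {y : DividedPower k} (hy : y ∈ N)
    {m : ℕ} (hm : (c k).repr y m ≠ 0) {i : ℕ} (hi : i ≤ m) : c k i ∈ N := by
  have hmem : m ∈ ((c k).repr y).support := Finsupp.mem_support_iff.2 hm
  obtain ⟨n, hmax⟩ := ((c k).repr y).support.exists_maximal ⟨m, hmem⟩
  refine c_mem_of_forall_repr_eq_zero hN hy (Finsupp.mem_support_iff.1 hmax.prop) (fun j hj ↦ ?_)
    (hi.trans (le_of_not_gt (hmax.not_gt hmem)))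
  exact Finsupp.notMem_support_iff.1 fun hmem ↦ hmax.not_gt hmem hj

theorem isLowerSet_setOf_c_mem (hN : IsRightCoideal k _ N) : IsLowerSet {n | c k n ∈ N} :=
  fun _ _ hji hi ↦ c_mem_of_repr_ne_zero hN hi (by simp) hji

theorem span_image_c_eq (hN : IsRightCoideal k _ N) :
    Submodule.span k (c k '' {n | c k n ∈ N}) = N := by
  refine le_antisymm (Submodule.span_le.2 (Set.image_subset_iff.2 fun n hn ↦ hn)) fun y hy ↦ ?_
  refine (c k).mem_span_image.2 fun n hn ↦ ?_
  exact c_mem_of_repr_ne_zero hN hy (Finsupp.mem_support_iff.1 hn) le_rfl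

theorem isChainCoalgebra : IsChainCoalgebra k (DividedPower k) where
  nontrivial := ⟨c k 0, 0, (c k).ne_zero 0⟩
  le_or_le := by
    rintro ⟨N, hN⟩ ⟨L, hL⟩
    rw [Subtype.mk_le_mk, Subtype.mk_le_mk, ← span_image_c_eq hN, ← span_image_c_eq hL]
    exact ((isLowerSet_setOf_c_mem hN).total (isLowerSet_setOf_c_mem hL)).imp
      (fun h ↦ Submodule.span_mono (Set.image_mono h))
      (fun h ↦ Submodule.span_mono (Set.image_mono h))

theorem isRightPointed : IsRightPointed k (DividedPower k) := by
  intro N hN h0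
  refine ⟨c k 0, ?_, by simp [counit_c], by simp [comul_c]⟩
  obtain ⟨y, hy, hy0⟩ := Submodule.exists_mem_ne_zero_of_ne_bot h0
  obtain ⟨m, hm⟩ := Finsupp.ne_iff.1 ((c k).repr.map_ne_zero_iff.2 hy0)
  exact c_mem_of_repr_ne_zero hN hy hm m.zero_le

/-- The span of `c₀, …, cₙ₋₁`. -/
noncomputable def truncation (k : Type u) [Field k] (n : ℕ) : Submodule k (DividedPower k) :=
  Submodule.span k (c k '' Set.Iio n)

theorem mem_truncation {n : ℕ} {y : DividedPower k} :
    y ∈ truncation k n ↔ ∀ m, n ≤ m → (c k).repr y m = 0 := by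
  rw [truncation, Module.Basis.mem_span_image]
  exact forall_congr' fun m ↦ by
    rw [Finset.mem_coe, Finsupp.mem_support_iff, Set.mem_Iio, not_imp_comm, not_lt]

instance (n : ℕ) : Module.Finite k (truncation k n) :=
  Module.Finite.span_of_finite k ((Set.finite_Iio n).image _)

theorem finrank_truncation (n : ℕ) : Module.finrank k (truncation k n) = n := by
  rw [truncation, Set.image_eq_range]
  exact (finrank_span_eq_card
    ((c k).linearIndependent.comp _ Subtype.val_injective)).trans (by simp)

theorem eq_top_or_eq_truncation (hN : IsRightCoideal k _ N) :
    N = ⊤ ∨ ∃ n, N = truncation k n := by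
  obtain h | ⟨n, h⟩ := (isLowerSet_setOf_c_mem hN).eq_univ_or_Iio
  · left
    rw [← span_image_c_eq hN, h, Set.image_univ, (c k).span_eq]
  · right
    exact ⟨n, by rw [← span_image_c_eq hN, h, truncation]⟩

end RightCoideals

end DividedPower

section Chain

variable {k C : Type*} [Field k] [AddCommGroup C] [Module k C] [Coalgebra k C]

theorem IsColinear.exists_pow_apply_eq_zero {T : Module.End k C} (hT : IsColinear T)
    (hker : ∀ N : Submodule k C, IsRightCoideal k C N → N ≠ ⊥ → N ⊓ LinearMap.ker T ≠ ⊥) (x : C) :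
    ∃ n, (T ^ n) x = 0 := by
  suffices ∃ n, rightCoidealSpan x ≤ LinearMap.ker (T ^ n) from
    this.imp fun n h ↦ h (mem_rightCoidealSpan_self x)
  refine (isRightCoideal_rightCoidealSpan x).induction_on_map
    (P := fun N ↦ ∃ n, N ≤ LinearMap.ker (T ^ n)) ⟨0, bot_le⟩ fun N hN h0 ↦
      ⟨T, hT, hker N hN h0, fun ⟨n, hn⟩ ↦ ?_⟩
  refine ⟨n + 1, fun y hy ↦ ?_⟩
  rw [LinearMap.mem_ker, pow_succ, Module.End.mul_apply]
  exact hn (Submodule.mem_map_of_mem hy)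

namespace IsChainCoalgebra

theorem exists_isGroupLikeElem_mem_of_ne_bot (hC : IsChainCoalgebra k C)
    (hpointed : IsRightPointed k C) : ∃ g : C, IsGroupLikeElem k g ∧
      ∀ N : Submodule k C, IsRightCoideal k C N → N ≠ ⊥ → g ∈ N := by
  have := hC.nontrivial
  obtain ⟨g, -, hg⟩ := hpointed ⊤ isRightCoideal_top top_ne_bot
  refine ⟨g, hg, fun N hN h0 ↦ ?_⟩
  obtain ⟨h, hhN, hh⟩ := hpointed N hN h0
  obtain hle | hle := hC.le_or_le ⟨N, hN⟩ ⟨k ∙ g, isRightCoideal_span_singleton hg⟩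
  · exact eq_of_mem_span_singleton_of_isGroupLikeElem hg hh (hle hhN) ▸ hhN
  · exact hle (Submodule.mem_span_singleton_self g)

/-- The form `f` is chosen not to vanish on the second smallest nonzero right coideal. -/
theorem exists_ker_rightHit_le_span_singleton (hC : IsChainCoalgebra k C) (g : C) :
    ∃ f : Module.Dual k C, f g = 0 ∧ LinearMap.ker (rightHit f) ≤ k ∙ g := by
  by_cases htop : (⊤ : Submodule k C) ≤ k ∙ g
  · exact ⟨0, rfl, le_top.trans htop⟩
  obtain ⟨x, -, hx⟩ := SetLike.not_le_iff_exists.1 htop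
  obtain ⟨S, -, -, hmin⟩ := exists_minimal_le_of_finite
    (P := fun N ↦ IsRightCoideal k C N ∧ ¬ N ≤ k ∙ g)
    ⟨isRightCoideal_rightCoidealSpan x, fun h ↦ hx (h (mem_rightCoidealSpan_self x))⟩
  obtain ⟨y, hyS, hy⟩ := SetLike.not_le_iff_exists.1 hmin.prop.2
  obtain ⟨f, hfy, hf⟩ := Submodule.exists_dual_map_eq_bot_of_notMem hy inferInstance
  have hfg : f g = 0 := by
    simpa [hf] using Submodule.mem_map_of_mem (f := f) (Submodule.mem_span_singleton_self g)
  refine ⟨f, hfg, not_imp_comm.1 (fun hker ↦ ?_) hfy⟩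
  have hcoideal := (isColinear_rightHit f).isRightCoideal_ker
  have hle : S ≤ LinearMap.ker (rightHit f) :=
    (hC.le_or_le ⟨S, hmin.prop.1⟩ ⟨_, hcoideal⟩).elim id (hmin.le_of_le ⟨hcoideal, hker⟩)
  simpa using congrArg (counit (R := k)) (hle hyS)

theorem exists_injective_dividedPower (hC : IsChainCoalgebra k C)
    (hpointed : IsRightPointed k C) :
    ∃ φ : C →ₗc[k] DividedPower k, Function.Injective φ := by
  obtain ⟨g, hg, hgN⟩ := hC.exists_isGroupLikeElem_mem_of_ne_bot hpointed
  obtain ⟨f, hfg, hker⟩ := hC.exists_ker_rightHit_le_span_singleton g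
  have hgker : g ∈ LinearMap.ker (rightHit f) := by
    simp [rightHit_of_isGroupLikeElem hg, hfg]
  have hnil := (isColinear_rightHit f).exists_pow_apply_eq_zero fun N hN h0 ↦
    (Submodule.ne_bot_iff _).2 ⟨g, ⟨hgN N hN h0, hgker⟩, hg.ne_zero⟩
  refine ⟨DividedPower.lift _ (isColinear_rightHit f) hnil, DividedPower.lift_injective _ hnil ?_⟩
  refine (Submodule.eq_bot_iff _).2 fun x ⟨hx, hcounit⟩ ↦ ?_
  obtain ⟨a, rfl⟩ := Submodule.mem_span_singleton.1 (hker hx)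
  have ha : a = 0 := by simpa [hg.counit_eq_one] using hcounit
  rw [ha, zero_smul]

end IsChainCoalgebra

end Chain

section FiniteDuals

namespace finiteDual

section Eval

variable {k : Type u} [Field k] {A : Type*} [Ring A] [Algebra k A] {x : A}

/-- Evaluation at `x` as a linear form on the finite dual. -/
noncomputable def eval (x : A) : Module.Dual k (finiteDual k A) :=
  LinearMap.applyₗ x ∘ₗ (finiteDual k A).subtype

@[simp]
theorem eval_apply (x : A) (f : finiteDual k A) : eval x f = f.1 x :=
  rfl

theorem rightHit_eval_apply (x : A) (f : finiteDual k A) (b : A) :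
    (rightHit (eval x) f).1 b = f.1 (x * b) := by
  have h : pairing k A (comul f) = f.1 ∘ₗ LinearMap.mul' k A := pairing_comulAux f
  rw [rightHit_eq_sum _ (ℛ k f), ← LinearMap.mul'_apply (R := k) (a := x), ← LinearMap.comp_apply,
    ← h, ← (ℛ k f).eq]
  simp

theorem rightHit_eval_pow_apply (x : A) (n : ℕ) (f : finiteDual k A) (b : A) :
    ((rightHit (eval x) ^ n) f).1 b = f.1 (x ^ n * b) := by
  induction n generalizing b with
  | zero => simp
  | succ n ih => rw [pow_succ', Module.End.mul_apply, rightHit_eval_apply, ih, pow_succ, mul_assoc]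

theorem exists_rightHit_eval_pow_eq_zero (hx : ∀ f : finiteDual k A, ∃ n, ∀ b, f.1 (x ^ n * b) = 0)
    (f : finiteDual k A) : ∃ n, (rightHit (eval x) ^ n) f = 0 :=
  (hx f).imp fun n hn ↦ Subtype.ext <| LinearMap.ext fun b ↦
    (rightHit_eval_pow_apply x n f b).trans (hn b)

/-- The coalgebra homomorphism `f ↦ ∑ₙ f(xⁿ) cₙ` from the finite dual to the divided power
coalgebra. -/
noncomputable def toDividedPower (x : A)
    (hx : ∀ f : finiteDual k A, ∃ n, ∀ b, f.1 (x ^ n * b) = 0) :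
    finiteDual k A →ₗc[k] DividedPower k :=
  DividedPower.lift (C := finiteDual k A) (rightHit (eval x)) (isColinear_rightHit _)
    (exists_rightHit_eval_pow_eq_zero hx)

theorem repr_toDividedPower (hx : ∀ f : finiteDual k A, ∃ n, ∀ b, f.1 (x ^ n * b) = 0)
    (f : finiteDual k A) (n : ℕ) :
    (DividedPower.c k).repr (toDividedPower x hx f) n = f.1 (x ^ n) := by
  refine (DividedPower.repr_liftLinear (C := finiteDual k A)
    (exists_rightHit_eval_pow_eq_zero hx) f n).trans ?_
  exact (rightHit_eval_pow_apply x n f 1).trans (by rw [mul_one])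

theorem toDividedPower_injective (hx : ∀ f : finiteDual k A, ∃ n, ∀ b, f.1 (x ^ n * b) = 0)
    (hA : ∀ a : A, ∃ r : k, x ∣ a - algebraMap k A r) :
    Function.Injective (toDividedPower x hx) := by
  refine DividedPower.lift_injective (C := finiteDual k A) _ _ <|
    (Submodule.eq_bot_iff _).2 fun f ⟨hf, hf1⟩ ↦ ?_
  refine Subtype.ext (LinearMap.ext fun a ↦ ?_)
  obtain ⟨r, b, hb⟩ := hA a
  have hf1 : f.1 1 = 0 := hf1
  have hfb : f.1 (x * b) = 0 := by
    rw [← rightHit_eval_apply, LinearMap.mem_ker.1 hf]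
    rfl
  rw [sub_eq_iff_eq_add.1 hb, map_add, hfb, Algebra.algebraMap_eq_smul_one, map_smul, hf1]
  simp

end Eval

section TruncatedPolynomials

open Polynomial

variable (k : Type u) [Field k] (n : ℕ)

theorem exists_injective_truncatedPolynomial_range_eq :
    ∃ φ : finiteDual k (k[X] ⧸ Ideal.span {(X : k[X]) ^ n}) →ₗc[k] DividedPower k,
      Function.Injective φ ∧ LinearMap.range φ.toLinearMap = DividedPower.truncation k n := by
  set I : Ideal k[X] := Ideal.span {(X : k[X]) ^ n}
  have hX : Ideal.Quotient.mk I X ^ n = 0 := by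
    rw [← map_pow, Ideal.Quotient.eq_zero_iff_mem]
    exact Ideal.mem_span_singleton_self _
  have hfin : Module.Finite k (k[X] ⧸ I) := (monic_X_pow n).finite_quotient
  have hnil (f : finiteDual k (k[X] ⧸ I)) : ∃ n, ∀ b, f.1 (Ideal.Quotient.mk I X ^ n * b) = 0 :=
    ⟨n, fun b ↦ by rw [hX, zero_mul, map_zero]⟩
  have hφ := toDividedPower_injective hnil fun a ↦ by
    obtain ⟨p, rfl⟩ := Ideal.Quotient.mk_surjective a
    exact ⟨p.coeff 0, (map_dvd (Ideal.Quotient.mk I) (X_dvd_sub_C (p := p))).trans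
      (map_sub (Ideal.Quotient.mk I) p (C (p.coeff 0))).dvd⟩
  refine ⟨toDividedPower _ hnil, hφ, ?_⟩
  have hle : LinearMap.range (toDividedPower _ hnil).toLinearMap ≤ DividedPower.truncation k n := by
    rintro _ ⟨f, rfl⟩
    refine DividedPower.mem_truncation.2 fun m hm ↦ (repr_toDividedPower hnil f m).trans ?_
    rw [pow_eq_zero_of_le hm hX, map_zero]
  refine Submodule.eq_of_le_of_finrank_eq hle ?_
  rw [LinearMap.finrank_range_of_inj hφ, finiteDual_eq_top, finrank_top, Subspace.dual_finrank_eq,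
    finrank_quotient_span_eq_natDegree, natDegree_X_pow, DividedPower.finrank_truncation]

end TruncatedPolynomials

section PowerSeries

open PowerSeries

variable {k : Type u} [Field k]

theorem exists_X_pow_mem_of_finite_quotient {I : Ideal k⟦X⟧}
    (hI : Module.Finite k (k⟦X⟧ ⧸ I.restrictScalars k)) : ∃ n, X ^ n ∈ I := by
  have hI0 : I ≠ ⊥ := by
    rintro rfl
    have : Module.Finite k k⟦X⟧ := .equiv (Submodule.quotEquivOfEqBot
      ((⊥ : Ideal k⟦X⟧).restrictScalars k) (Submodule.restrictScalars_bot k _ _))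
    exact Polynomial.not_finite (R := k) <| .of_injective
      (Polynomial.coeToPowerSeries.algHom k).toLinearMap <|
        (Polynomial.coe_injective k).comp fun p q h ↦ by
          simpa [Polynomial.coeToPowerSeries.algHom_apply] using h
  obtain ⟨n, hn⟩ := IsDiscreteValuationRing.ideal_eq_span_pow_irreducible hI0
    (X_irreducible (R := k))
  exact ⟨n, hn ▸ Ideal.mem_span_singleton_self _⟩

theorem coeff_mem (n : ℕ) : coeff n ∈ finiteDual k k⟦X⟧ := by
  let I : Ideal k⟦X⟧ := Ideal.span {X ^ (n + 1)}
  have hI {p : k⟦X⟧} : p ∈ I ↔ ∀ m < n + 1, coeff m p = 0 := by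
    rw [Ideal.mem_span_singleton, X_pow_dvd_iff]
  let ψ : k⟦X⟧ →ₗ[k] Fin (n + 1) → k := LinearMap.pi fun i ↦ coeff i
  have hψ : LinearMap.ker ψ = I.restrictScalars k := by
    ext p
    simp [ψ, hI, funext_iff, Fin.forall_iff]
  exact ⟨I, inferInstance, hψ ▸ .equiv ψ.quotKerEquivRange.symm,
    fun p hp ↦ hI.1 hp n n.lt_succ_self⟩

variable (k) in
theorem exists_injective_powerSeries_range_eq_top :
    ∃ φ : finiteDual k k⟦X⟧ →ₗc[k] DividedPower k,
      Function.Injective φ ∧ LinearMap.range φ.toLinearMap = ⊤ := by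
  have hnil (f : finiteDual k k⟦X⟧) : ∃ n, ∀ b, f.1 (X ^ n * b) = 0 := by
    obtain ⟨f, I, hI, hfin, hf⟩ := f
    exact (exists_X_pow_mem_of_finite_quotient hfin).imp fun n hn b ↦ hf _ (I.mul_mem_right b hn)
  refine ⟨toDividedPower X hnil, toDividedPower_injective hnil fun p ↦
    ⟨constantCoeff p, _, sub_const_eq_X_mul_shift p⟩, ?_⟩
  refine eq_top_iff.2 fun y _ ↦ DividedPower.mem_of_forall_c_mem fun n _ ↦ ?_
  refine ⟨⟨coeff n, coeff_mem n⟩, (DividedPower.c k).repr.injective (Finsupp.ext fun m ↦ ?_)⟩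
  refine (repr_toDividedPower hnil _ m).trans ?_
  rw [Module.Basis.repr_self, Finsupp.single_apply, coeff_X_pow]

end PowerSeries

end finiteDual

open Polynomial PowerSeries in
theorem nontrivial_and_exists_injective_dividedPower_iff {k : Type u} [Field k] {C : Type v}
    [AddCommGroup C] [Module k C] [Coalgebra k C] :
    (Nontrivial C ∧ ∃ φ : C →ₗc[k] DividedPower k, Function.Injective φ) ↔
      (∃ n : ℕ, 0 < n ∧
        Nonempty (C ≃ₗc[k] finiteDual k (k[X] ⧸ Ideal.span {(Polynomial.X : k[X]) ^ n}))) ∨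
      Nonempty (C ≃ₗc[k] finiteDual k k⟦X⟧) := by
  constructor
  · rintro ⟨hC, φ, hφ⟩
    obtain htop | ⟨n, hn⟩ :=
      DividedPower.eq_top_or_eq_truncation (Subcoalgebra.range φ).isRightCoideal
    · obtain ⟨ψ, hψ, hrange⟩ := finiteDual.exists_injective_powerSeries_range_eq_top k
      exact .inr (nonempty_coalgEquiv_of_range_eq (D := finiteDual k k⟦X⟧) hφ hψ
        (htop.trans hrange.symm))
    · obtain ⟨ψ, hψ, hrange⟩ := finiteDual.exists_injective_truncatedPolynomial_range_eq k n
      refine .inl ⟨n, ?_, nonempty_coalgEquiv_of_range_eq (D := finiteDual k (k[X] ⧸ _)) hφ hψ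
        (hn.trans hrange.symm)⟩
      rw [← DividedPower.finrank_truncation (k := k) n, Module.finrank_pos_iff, ← hn]
      exact (LinearEquiv.ofInjective φ.toLinearMap hφ).toEquiv.symm.nontrivial
  · rintro (⟨n, hn, ⟨e⟩⟩ | he)
    · obtain ⟨ψ, hψ, hrange⟩ := finiteDual.exists_injective_truncatedPolynomial_range_eq k n
      refine ⟨?_, ψ.comp e.toCoalgHom, hψ.comp e.toEquiv.injective⟩
      rw [← DividedPower.finrank_truncation (k := k) n, Module.finrank_pos_iff, ← hrange] at hn
      exact (e.toLinearEquiv.trans (LinearEquiv.ofInjective ψ.toLinearMap hψ)).toEquiv.nontrivial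
    · obtain ⟨e⟩ := he
      obtain ⟨ψ, hψ, -⟩ := finiteDual.exists_injective_powerSeries_range_eq_top k
      refine ⟨?_, ψ.comp e.toCoalgHom, hψ.comp e.toEquiv.injective⟩
      have : Nontrivial (finiteDual k k⟦X⟧) := ⟨⟨⟨coeff 0, finiteDual.coeff_mem 0⟩, 0, fun h ↦ by
        simpa using congr($h.1 1)⟩⟩
      exact e.toEquiv.nontrivial

end FiniteDuals

section Components

variable {k C : Type*} [Field k] [AddCommGroup C] [Module k C] [Coalgebra k C] {g : C}

variable (k) in
/-- The sum of all right coideals whose only possible group-like element is `g`. -/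
def component (g : C) : Submodule k C :=
  sSup {N | IsRightCoideal k C N ∧ ∀ h ∈ N, IsGroupLikeElem k h → h = g}

theorem isRightCoideal_component (g : C) : IsRightCoideal k C (component k g) :=
  isRightCoideal_sSup fun _ hN ↦ hN.1

theorem IsRightCoideal.le_component {N : Submodule k C} (hN : IsRightCoideal k C N)
    (h : ∀ h ∈ N, IsGroupLikeElem k h → h = g) : N ≤ component k g :=
  le_sSup (a := N) ⟨hN, h⟩

theorem mem_component_self (hg : IsGroupLikeElem k g) : g ∈ component k g :=
  (isRightCoideal_span_singleton hg).le_component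
    (fun _ hh hgroup ↦ eq_of_mem_span_singleton_of_isGroupLikeElem hg hgroup hh)
    (Submodule.mem_span_singleton_self g)

namespace IsDistributiveCoalgebra

theorem notMem_sup_of_isGroupLikeElem (hC : IsDistributiveCoalgebra k C)
    (hg : IsGroupLikeElem k g) {N L : Submodule k C} (hN : IsRightCoideal k C N)
    (hL : IsRightCoideal k C L) (hgN : g ∉ N) (hgL : g ∉ L) : g ∉ N ⊔ L := by
  rw [← Submodule.disjoint_span_singleton' hg.ne_zero, disjoint_comm, disjoint_iff] at hgN hgL ⊢
  rw [hC.inf_sup_eq (isRightCoideal_span_singleton hg) hN hL, hgN, hgL, bot_sup_eq]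

theorem notMem_sSup_of_isGroupLikeElem (hC : IsDistributiveCoalgebra k C)
    (hg : IsGroupLikeElem k g) {𝒩 : Set (Submodule k C)} (h𝒩 : ∀ N ∈ 𝒩, IsRightCoideal k C N)
    (hg𝒩 : ∀ N ∈ 𝒩, g ∉ N) : g ∉ sSup 𝒩 := by
  rw [Submodule.mem_sSup_iff_exists_finset]
  rintro ⟨s, hs, hgs⟩
  have hsup : IsRightCoideal k C (s.sup id) ∧ g ∉ s.sup id := by
    refine Finset.sup_induction (p := fun N ↦ IsRightCoideal k C N ∧ g ∉ N)
      ⟨isRightCoideal_bot, by simpa using hg.ne_zero⟩ ?_ fun N hN ↦ ⟨h𝒩 N (hs hN), hg𝒩 N (hs hN)⟩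
    rintro N ⟨hN, hgN⟩ L ⟨hL, hgL⟩
    exact ⟨hN.sup hL, hC.notMem_sup_of_isGroupLikeElem hg hN hL hgN hgL⟩
  exact hsup.2 (by simpa [Finset.sup_eq_iSup] using hgs)

theorem eq_of_mem_component (hC : IsDistributiveCoalgebra k C) {h : C}
    (hh : IsGroupLikeElem k h) (hmem : h ∈ component k g) : h = g := by
  by_contra hne
  exact hC.notMem_sSup_of_isGroupLikeElem hh (fun N hN ↦ hN.1)
    (fun N hN hhN ↦ hne (hN.2 h hhN hh)) hmem

theorem map_rightHit_component_le (hC : IsDistributiveCoalgebra k C) (f : Module.Dual k C) (g : C) :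
    (component k g).map (rightHit f) ≤ component k g := by
  have hcomponent := isRightCoideal_component (k := k) g
  refine (hcomponent.map (isColinear_rightHit f)).le_component fun h hmem hh ↦ ?_
  by_contra hne
  have hdisjoint : component k g ⊓ k ∙ h = ⊥ := disjoint_iff.1 <|
    (Submodule.disjoint_span_singleton' hh.ne_zero).2 fun hh' ↦ hne (hC.eq_of_mem_component hh hh')
  have hbot := hC.map_inf_map_eq_bot hcomponent (isRightCoideal_span_singleton hh)
    (isColinear_rightHit f) .one (hdisjoint ▸ bot_le) (hdisjoint ▸ bot_le)
  refine hh.ne_zero ((Submodule.eq_bot_iff _).1 hbot h ⟨hmem, h, ?_, rfl⟩)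
  exact Submodule.mem_span_singleton_self h

/-- In a distributive coalgebra the component of `g` is a subcoalgebra. -/
def componentSubcoalgebra (hC : IsDistributiveCoalgebra k C) (g : C) : Subcoalgebra k C :=
  .ofStable (component k g) (isRightCoideal_component g)
    fun f x hx ↦ hC.map_rightHit_component_le f g ⟨x, hx, rfl⟩

theorem exists_mem_map_rightHit (hC : IsDistributiveCoalgebra k C) (hpointed : IsRightPointed k C)
    {N W : Submodule k C} (hN : IsRightCoideal k C N) (hNg : N ≤ component k g) (hNW : ¬ N ≤ W) :
    ∃ f : Module.Dual k C, W ≤ LinearMap.ker f ∧ g ∈ N.map (rightHit f) := by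
  obtain ⟨z, hz, hzW⟩ := SetLike.not_le_iff_exists.1 hNW
  obtain ⟨f, hfz, hf⟩ := Submodule.exists_dual_map_eq_bot_of_notMem hzW inferInstance
  have h0 : N.map (rightHit f) ≠ ⊥ := (Submodule.ne_bot_iff _).2
    ⟨_, Submodule.mem_map_of_mem hz, fun h ↦ hfz (by rw [← counit_rightHit, h, map_zero])⟩
  obtain ⟨h, hmem, hh⟩ := hpointed _ (hN.map (isColinear_rightHit f)) h0
  obtain rfl := hC.eq_of_mem_component hh
    (hC.map_rightHit_component_le f g (Submodule.map_mono hNg hmem))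
  exact ⟨f, LinearMap.le_ker_iff_map.2 hf, hmem⟩

theorem le_or_le_of_le_component (hC : IsDistributiveCoalgebra k C)
    (hpointed : IsRightPointed k C) (hg : IsGroupLikeElem k g) {X Y : Submodule k C}
    (hX : IsRightCoideal k C X) (hY : IsRightCoideal k C Y) (hXg : X ≤ component k g)
    (hYg : Y ≤ component k g) : X ≤ Y ∨ Y ≤ X := by
  by_contra! hne
  obtain ⟨f, hf, hgf⟩ := hC.exists_mem_map_rightHit hpointed hX hXg (W := X ⊓ Y)
    fun h ↦ hne.1 (h.trans inf_le_right)
  obtain ⟨f', hf', hgf'⟩ := hC.exists_mem_map_rightHit hpointed hY hYg (W := X ⊓ Y)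
    fun h ↦ hne.2 (h.trans inf_le_left)
  have hbot := hC.map_inf_map_eq_bot hX hY (isColinear_rightHit f) (isColinear_rightHit f')
    ((hX.inf hY).le_ker_rightHit hf) ((hX.inf hY).le_ker_rightHit hf')
  exact hg.ne_zero ((Submodule.eq_bot_iff _).1 hbot g ⟨hgf, hgf'⟩)

theorem isChainCoalgebra_componentSubcoalgebra (hC : IsDistributiveCoalgebra k C)
    (hpointed : IsRightPointed k C) (hg : IsGroupLikeElem k g) :
    IsChainCoalgebra k (hC.componentSubcoalgebra g).toSubmodule := by
  let D := hC.componentSubcoalgebra g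
  have : Nontrivial D.toSubmodule :=
    ⟨⟨g, mem_component_self hg⟩, 0, fun h ↦ hg.ne_zero (congrArg Subtype.val h)⟩
  have hrange : LinearMap.range D.subtype.toLinearMap = component k g := Submodule.range_subtype _
  refine .of_injective_of_comparable D.subtype_injective fun N hN L hL hcN hcL ↦ ?_
  exact hC.le_or_le_of_le_component hpointed hg hcN hcL (hrange ▸ hN) (hrange ▸ hL)

theorem iSupIndep_component (hC : IsDistributiveCoalgebra k C) (hpointed : IsRightPointed k C) :
    iSupIndep fun g : GroupLike k C ↦ component k g.val := by
  intro g
  change Disjoint _ (⨆ h ∈ {h | h ≠ g}, component k h.val)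
  rw [disjoint_iff, ← sSup_image]
  have hcoideal : ∀ N ∈ (fun h : GroupLike k C ↦ component k h.val) '' {h | h ≠ g},
      IsRightCoideal k C N := by
    rintro _ ⟨h, -, rfl⟩
    exact isRightCoideal_component _
  by_contra h0
  obtain ⟨h, ⟨hg, hsup⟩, hh⟩ := hpointed _
    ((isRightCoideal_component _).inf (isRightCoideal_sSup hcoideal)) h0
  refine hC.notMem_sSup_of_isGroupLikeElem hh hcoideal ?_ hsup
  rintro _ ⟨h', hne, rfl⟩ hmem
  exact hne (GroupLike.val_injective
    ((hC.eq_of_mem_component hh hmem).symm.trans (hC.eq_of_mem_component hh hg)))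

/-- The form `f` vanishes on the largest right coideal that does not contain `g`. -/
theorem exists_map_rightHit_le_component (hC : IsDistributiveCoalgebra k C)
    (hg : IsGroupLikeElem k g) :
    ∃ f : Module.Dual k C, f g = 1 ∧ ∀ x, rightHit f x ∈ component k g := by
  let M : Submodule k C := sSup {N | IsRightCoideal k C N ∧ g ∉ N}
  have hM : IsRightCoideal k C M := isRightCoideal_sSup fun _ hN ↦ hN.1
  have hgM : g ∉ M :=
    hC.notMem_sSup_of_isGroupLikeElem hg (fun _ hN ↦ hN.1) fun _ hN ↦ hN.2
  obtain ⟨f₀, hf₀g, hf₀⟩ := Submodule.exists_dual_map_eq_bot_of_notMem hgM inferInstance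
  obtain ⟨f, hfg, hf⟩ : ∃ f : Module.Dual k C, f g = 1 ∧ M ≤ LinearMap.ker f :=
    ⟨(f₀ g)⁻¹ • f₀, inv_mul_cancel₀ hf₀g, (LinearMap.le_ker_iff_map.2 hf₀).trans
      fun x hx ↦ by simp_all⟩
  refine ⟨f, hfg, fun x ↦ ?_⟩
  refine (isRightCoideal_top.map (isColinear_rightHit f)).le_component ?_
    (Submodule.mem_map_of_mem (Submodule.mem_top (x := x)))
  rintro _ ⟨y, -, rfl⟩ hh
  have hg' : g ∈ (k ∙ rightHit f y).comap (rightHit f) := by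
    by_contra hg'
    have hle : (k ∙ rightHit f y).comap (rightHit f) ≤ M :=
      le_sSup ⟨(isRightCoideal_span_singleton hh).comap (isColinear_rightHit f), hg'⟩
    exact hh.ne_zero (hM.le_ker_rightHit hf (hle (Submodule.mem_span_singleton_self _)))
  rw [Submodule.mem_comap, rightHit_of_isGroupLikeElem hg, hfg, one_smul] at hg'
  exact (eq_of_mem_span_singleton_of_isGroupLikeElem hh hg hg').symm

theorem iSup_component (hC : IsDistributiveCoalgebra k C) (hpointed : IsRightPointed k C) :
    ⨆ g : GroupLike k C, component k g.val = ⊤ := by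
  refine eq_top_iff.2 fun x _ ↦ ?_
  suffices rightCoidealSpan x ≤ ⨆ g : GroupLike k C, component k g.val from
    this (mem_rightCoidealSpan_self x)
  refine (isRightCoideal_rightCoidealSpan x).induction_on_map
    (P := (· ≤ ⨆ g : GroupLike k C, component k g.val)) bot_le fun N hN h0 ↦ ?_
  obtain ⟨g, hgN, hg⟩ := hpointed N hN h0
  obtain ⟨f, hfg, hf⟩ := hC.exists_map_rightHit_le_component hg
  have hker : rightHit (counit - f) g = 0 := by
    simp [rightHit_of_isGroupLikeElem hg, hg.counit_eq_one, hfg]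
  refine ⟨rightHit (counit - f), isColinear_rightHit _,
    (Submodule.ne_bot_iff _).2 ⟨g, ⟨hgN, hker⟩, hg.ne_zero⟩, fun hmap y hy ↦ ?_⟩
  have hsum : y = rightHit f y + rightHit (counit - f) y := by simp
  rw [hsum]
  exact add_mem (le_iSup (fun g : GroupLike k C ↦ component k g.val) ⟨g, hg⟩ (hf y))
    (hmap (Submodule.mem_map_of_mem hy))

end IsDistributiveCoalgebra

end Components

section DirectSums

variable {k ι C : Type*} [DecidableEq ι] {A : ι → Type*} [AddCommGroup C]
  [∀ i, AddCommGroup (A i)]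

section CommRing

variable [CommRing k] [Module k C] [Coalgebra k C] [∀ i, Module k (A i)] [∀ i, Coalgebra k (A i)]

variable (k A) in
/-- The inclusion of a summand in a direct sum of coalgebras. -/
def singleHom (i : ι) : A i →ₗc[k] Π₀ i, A i where
  toLinearMap := DFinsupp.lsingle i
  counit_comp := DFinsupp.counit_comp_lsingle k ι A i
  map_comp_comul := (DFinsupp.comul_comp_lsingle k ι A i).symm

@[simp]
theorem singleHom_apply (i : ι) (a : A i) : singleHom k A i a = DFinsupp.single i a := rfl

theorem singleHom_injective (i : ι) : Function.Injective (singleHom k A i) :=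
  DFinsupp.single_injective

/-- The coalgebra homomorphism out of a direct sum given by homomorphisms out of the summands. -/
def sumHom (ψ : ∀ i, A i →ₗc[k] C) : (Π₀ i, A i) →ₗc[k] C where
  toLinearMap := DFinsupp.lsum k fun i ↦ (ψ i).toLinearMap
  counit_comp := DFinsupp.lhom_ext fun i a ↦ by simp
  map_comp_comul := by
    refine DFinsupp.lhom_ext fun i a ↦ ?_
    rw [LinearMap.comp_apply, LinearMap.comp_apply, DFinsupp.comul_single, DFinsupp.lsum_single]
    refine Eq.trans ?_ (CoalgHomClass.map_comp_comul_apply (ψ i) a)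
    rw [← LinearMap.comp_apply, ← TensorProduct.map_comp]
    congr 2 <;> (ext a; simp)

theorem leftHit_counit_comp_lapply (i : ι) (x : Π₀ i, A i) :
    leftHit (counit ∘ₗ (DFinsupp.lapply i : (Π₀ i, A i) →ₗ[k] A i)) x =
      DFinsupp.single i (x i) := by
  induction x using DFinsupp.induction with
  | h0 => simp
  | ha j a x _ _ ih =>
    rw [map_add, ih, DFinsupp.add_apply, DFinsupp.single_add, ← singleHom_apply (k := k),
      leftHit_coalgHom]
    congr 1
    rcases eq_or_ne j i with rfl | hne
    · have hcounit : (counit ∘ₗ (DFinsupp.lapply j : (Π₀ i, A i) →ₗ[k] A j)) ∘ₗ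
          (singleHom k A j).toLinearMap = counit := by
        ext a
        simp
      rw [hcounit]
      simp
    · have hzero : (counit ∘ₗ (DFinsupp.lapply i : (Π₀ i, A i) →ₗ[k] A i)) ∘ₗ
          (singleHom k A j).toLinearMap = 0 := by
        ext a
        simp [DFinsupp.single_eq_of_ne hne.symm]
      rw [hzero]
      simp [DFinsupp.single_eq_of_ne hne.symm]

end CommRing

variable [Field k] [Module k C] [Coalgebra k C] [∀ i, Module k (A i)] [∀ i, Coalgebra k (A i)]

theorem IsRightCoideal.single_mem {N : Submodule k (Π₀ i, A i)} (hN : IsRightCoideal k _ N)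
    {x : Π₀ i, A i} (hx : x ∈ N) (i : ι) : DFinsupp.single i (x i) ∈ N :=
  leftHit_counit_comp_lapply (k := k) i x ▸ hN.leftHit_mem _ hx

theorem isDistributiveCoalgebra_dfinsupp (hA : ∀ i, IsDistributiveCoalgebra k (A i)) :
    IsDistributiveCoalgebra k (Π₀ i, A i) := by
  classical
  rintro ⟨N, hN⟩ ⟨L, hL⟩ ⟨M, hM⟩
  refine le_antisymm ?_ le_inf_sup
  change N ⊓ (L ⊔ M) ≤ (N ⊓ L) ⊔ (N ⊓ M)
  rintro x ⟨hxN, hx⟩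
  obtain ⟨l, hl, m, hm, rfl⟩ := Submodule.mem_sup.1 hx
  rw [← DFinsupp.sum_single (f := l + m)]
  refine Submodule.sum_mem _ fun i _ ↦ ?_
  have hinj := singleHom_injective (k := k) (A := A) i
  have hi : (l + m) i ∈ N.comap (singleHom k A i).toLinearMap ⊓
      (L.comap (singleHom k A i).toLinearMap ⊔ M.comap (singleHom k A i).toLinearMap) :=
    ⟨hN.single_mem hxN i, Submodule.add_mem_sup (hL.single_mem hl i) (hM.single_mem hm i)⟩
  rw [(hA i).inf_sup_eq (hN.comap_coalgHom hinj) (hL.comap_coalgHom hinj)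
    (hM.comap_coalgHom hinj)] at hi
  obtain ⟨y, ⟨hyN, hyL⟩, z, ⟨hzN, hzM⟩, hyz⟩ := Submodule.mem_sup.1 hi
  rw [← hyz, DFinsupp.single_add]
  exact Submodule.add_mem_sup ⟨hyN, hyL⟩ ⟨hzN, hzM⟩

theorem isRightPointed_dfinsupp (hA : ∀ i, IsRightPointed k (A i)) :
    IsRightPointed k (Π₀ i, A i) := by
  intro N hN h0
  obtain ⟨x, hxN, hx⟩ := N.exists_mem_ne_zero_of_ne_bot h0
  obtain ⟨i, hi⟩ := DFunLike.ne_iff.1 hx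
  obtain ⟨g, hgN, hg⟩ := hA i _ (hN.comap_coalgHom (singleHom_injective i))
    (Submodule.ne_bot_iff _ |>.2 ⟨x i, hN.single_mem hxN i, hi⟩)
  exact ⟨_, hgN, hg.map (singleHom k A i)⟩

theorem nonempty_coalgEquiv_dfinsupp {D : ι → Subcoalgebra k C}
    (hind : iSupIndep fun i ↦ (D i).toSubmodule) (hsup : ⨆ i, (D i).toSubmodule = ⊤)
    (e : ∀ i, (D i).toSubmodule ≃ₗc[k] A i) : Nonempty (C ≃ₗc[k] Π₀ i, A i) := by
  let Ψ : (Π₀ i, A i) →ₗc[k] C := sumHom fun i ↦ (D i).subtype.comp (e i).symm.toCoalgHom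
  have hΨ : ⇑Ψ = DFinsupp.lsum ℕ (fun i ↦ (D i).toSubmodule.subtype) ∘
      DFinsupp.mapRange.linearEquiv fun i ↦ (e i).symm.toLinearEquiv := by
    ext x
    induction x using DFinsupp.induction with
    | h0 => simp
    | ha i a x _ _ ih =>
      simp only [Function.comp_apply, map_add] at ih ⊢
      rw [ih]
      congr 1
  have hbij : Function.Bijective Ψ := by
    rw [hΨ]
    exact Function.Bijective.comp ⟨hind.dfinsupp_lsum_injective, fun x ↦
      (Submodule.mem_iSup_iff_exists_dfinsupp _ x).1 (hsup ▸ Submodule.mem_top)⟩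
      (LinearEquiv.bijective _)
  exact ⟨(CoalgEquiv.ofBijective hbij).symm⟩

end DirectSums

section Classification

variable {k : Type u} {C : Type v} [Field k] [AddCommGroup C] [Module k C] [Coalgebra k C]

theorem isChainCoalgebra_and_isPointedCoalgebra_iff :
    IsChainCoalgebra k C ∧ IsPointedCoalgebra k C ↔
      ∃ S : Subcoalgebra k (DividedPower k), S.toSubmodule ≠ ⊥ ∧
        Nonempty (C ≃ₗc[k] S.toSubmodule) := by
  rw [exists_nonempty_coalgEquiv_subcoalgebra_iff]
  constructor
  · rintro ⟨hC, hpointed⟩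
    exact ⟨hC.nontrivial,
      hC.exists_injective_dividedPower (hC.isDistributiveCoalgebra.isRightPointed hpointed)⟩
  · rintro ⟨_, φ, hφ⟩
    exact ⟨.of_injective DividedPower.isChainCoalgebra hφ,
      (DividedPower.isRightPointed.of_injective hφ).isPointedCoalgebra⟩

theorem IsDistributiveCoalgebra.exists_nonempty_coalgEquiv_dfinsupp
    (hC : IsDistributiveCoalgebra k C) (hpointed : IsPointedCoalgebra k C) :
    ∃ (ι : Type v) (_ : DecidableEq ι) (S : ι → Subcoalgebra k (DividedPower k)),
      (∀ i, (S i).toSubmodule ≠ ⊥) ∧ Nonempty (C ≃ₗc[k] Π₀ i, (S i).toSubmodule) := by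
  classical
  have hright := hC.isRightPointed hpointed
  have hcomponent (g : GroupLike k C) : ∃ S : Subcoalgebra k (DividedPower k),
      S.toSubmodule ≠ ⊥ ∧
        Nonempty ((hC.componentSubcoalgebra g.val).toSubmodule ≃ₗc[k] S.toSubmodule) := by
    have hchain := hC.isChainCoalgebra_componentSubcoalgebra hright g.isGroupLikeElem_val
    exact exists_nonempty_coalgEquiv_subcoalgebra_iff.2 ⟨hchain.nontrivial,
      hchain.exists_injective_dividedPower
        (hright.of_injective (hC.componentSubcoalgebra g.val).subtype_injective)⟩
  choose S hS e using hcomponent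
  exact ⟨GroupLike k C, inferInstance, S, hS, nonempty_coalgEquiv_dfinsupp
    (D := fun g : GroupLike k C ↦ hC.componentSubcoalgebra g.val) (hC.iSupIndep_component hright)
    (hC.iSup_component hright) fun g ↦ (e g).some⟩

theorem isDistributiveCoalgebra_and_isPointedCoalgebra_iff :
    IsDistributiveCoalgebra k C ∧ IsPointedCoalgebra k C ↔
      ∃ (ι : Type v) (_ : DecidableEq ι) (S : ι → Subcoalgebra k (DividedPower k)),
        (∀ i, (S i).toSubmodule ≠ ⊥) ∧ Nonempty (C ≃ₗc[k] Π₀ i, (S i).toSubmodule) := by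
  refine ⟨fun ⟨hC, hpointed⟩ ↦ hC.exists_nonempty_coalgEquiv_dfinsupp hpointed, ?_⟩
  rintro ⟨ι, _, S, -, ⟨e⟩⟩
  have he : Function.Injective e.toCoalgHom := e.toEquiv.injective
  have hdistrib (i : ι) : IsDistributiveCoalgebra k (S i).toSubmodule :=
    DividedPower.isChainCoalgebra.isDistributiveCoalgebra.of_injective (S i).subtype_injective
  have hpointed (i : ι) : IsRightPointed k (S i).toSubmodule :=
    DividedPower.isRightPointed.of_injective (S i).subtype_injective
  exact ⟨(isDistributiveCoalgebra_dfinsupp hdistrib).of_injective he,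
    ((isRightPointed_dfinsupp hpointed).of_injective he).isPointedCoalgebra⟩

end Classification

theorem mainTheorem8 {k : Type u} [Field k] :
    -- pointed chain coalgebras are the nonzero subcoalgebras of the divided power coalgebra
    (∀ (C : Type v) [AddCommGroup C] [Module k C] [Coalgebra k C],
      (IsChainCoalgebra k C ∧ IsPointedCoalgebra k C ↔
        ∃ S : Subcoalgebra k (DividedPower k), S.toSubmodule ≠ ⊥ ∧
          Nonempty (C ≃ₗc[k] S.toSubmodule))) ∧
    -- these are the duals of truncated polynomial rings and the finite dual of `k⟦X⟧`
    (∀ (C : Type v) [AddCommGroup C] [Module k C] [Coalgebra k C],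
      ((∃ S : Subcoalgebra k (DividedPower k), S.toSubmodule ≠ ⊥ ∧
          Nonempty (C ≃ₗc[k] S.toSubmodule)) ↔
        (∃ n : ℕ, 0 < n ∧ Nonempty (C ≃ₗc[k] finiteDual k
          (Polynomial k ⧸ Ideal.span {(Polynomial.X : Polynomial k) ^ n}))) ∨
        Nonempty (C ≃ₗc[k] finiteDual k (PowerSeries k)))) ∧
    -- over an algebraically closed field
    (IsAlgClosed k →
      ∀ (C : Type v) [AddCommGroup C] [Module k C] [Coalgebra k C],
        (IsChainCoalgebra k C ↔
          ∃ S : Subcoalgebra k (DividedPower k), S.toSubmodule ≠ ⊥ ∧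
            Nonempty (C ≃ₗc[k] S.toSubmodule)) ∧
        (IsDistributiveCoalgebra k C ↔
          ∃ (ι : Type v) (_ : DecidableEq ι) (S : ι → Subcoalgebra k (DividedPower k)),
            (∀ i, (S i).toSubmodule ≠ ⊥) ∧
              Nonempty (C ≃ₗc[k] Π₀ i, (S i).toSubmodule))) := by
  refine ⟨fun C _ _ _ ↦ isChainCoalgebra_and_isPointedCoalgebra_iff, fun C _ _ _ ↦
    exists_nonempty_coalgEquiv_subcoalgebra_iff.trans
      nontrivial_and_exists_injective_dividedPower_iff, fun _ C _ _ _ ↦ ⟨?_, ?_⟩⟩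
  · rw [← isChainCoalgebra_and_isPointedCoalgebra_iff, iff_self_and]
    exact fun hC ↦ hC.isDistributiveCoalgebra.isPointedCoalgebra_of_isAlgClosed
  · rw [← isDistributiveCoalgebra_and_isPointedCoalgebra_iff, iff_self_and]
    exact fun hC ↦ hC.isPointedCoalgebra_of_isAlgClosed
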